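/- Let $K$ be a field and let $Q=(Q_0,Q_1,s,r)$ be an arbitrary quiver. Let $\widehat Q$ be its Kronecker square, that is, the quiver with vertex set $Q_0\times Q_0$ and arrow set $Q_1\times Q_1$, where the arrow $[e,f]$ has source $[s(e),s(f)]$ and range $[r(e),r(f)]$. For a quiver $E$, let $L_K(E)$ denote its Leavitt path algebra: the associative (not necessarily unital) $K$-algebra generated by $\{v,e,e^*: v\in E_0,\ e\in E_1\}$ subject to the relations (1) $vw=\delta_{v,w}v$ for all $v,w\in E_0$; (2) $s(e)e=e=e\,r(e)$ for all $e\in E_1$; (3) $r(e)e^*=e^*=e^*s(e)$ for all $e\in E_1$; (4) $e^*f=\delta_{e,f}\,r(e)$ for all $e,f\in E_1$; (5) $v=\sum_{e\in E_1,\ s(e)=v}ee^*$ for every vertex $v$ that emits at least one and only finitely many arrows. A (not necessarily unital) ring $R$ is von Neumann regular if for every $a\in R$ there is $b\in R$ with $aba=a$; it is left (right) noetherian if its left (right) ideals satisfy the ascending chain condition, and left (right) artinian if they satisfy the descending chain condition. **Theorem.** 1. $L_K(Q)$ is von Neumann regular if and only if $L_K(\widehat Q)$ is von Neumann regular. 2.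 $L_K(Q)$ is left noetherian if and only if $L_K(\widehat Q)$ is left noetherian, and $L_K(Q)$ is right noetherian if and only if $L_K(\widehat Q)$ is right noetherian. 3. $L_K(Q)$ is left artinian if and only if $L_K(\widehat Q)$ is left artinian, and $L_K(Q)$ is right artinian if and only if $L_K(\widehat Q)$ is right artinian. -/

import Mathlib

universe u v w

/-! ### Chain conditions and regularity for rings that need not have an identity -/

section RingProperties

variable (R : Type u) [NonUnitalRing R]

/-- A left ideal of a (not necessarily unital) ring: an additive subgroup `I` with `R I ⊆ I`. -/
structure NonUnitalLeftIdeal extends AddSubgroup R where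
  mul_mem_left : ∀ (r : R) {x : R}, x ∈ carrier → r * x ∈ carrier

/-- A right ideal of a (not necessarily unital) ring: an additive subgroup `I` with `I R ⊆ I`. -/
structure NonUnitalRightIdeal extends AddSubgroup R where
  mul_mem_right : ∀ (r : R) {x : R}, x ∈ carrier → x * r ∈ carrier

/-- Left ideals are ordered by inclusion. -/
instance NonUnitalLeftIdeal.instPartialOrder : PartialOrder (NonUnitalLeftIdeal R) :=
  PartialOrder.lift NonUnitalLeftIdeal.toAddSubgroup
    (by rintro ⟨I, hI⟩ ⟨J, hJ⟩ h; cases h; rfl)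

/-- Right ideals are ordered by inclusion. -/
instance NonUnitalRightIdeal.instPartialOrder : PartialOrder (NonUnitalRightIdeal R) :=
  PartialOrder.lift NonUnitalRightIdeal.toAddSubgroup
    (by rintro ⟨I, hI⟩ ⟨J, hJ⟩ h; cases h; rfl)

/-- Von Neumann regularity: every `a` can be written as `a b a`. -/
def IsVonNeumannRegular : Prop := ∀ a : R, ∃ b : R, a * b * a = a

/-- Ascending chain condition on left ideals. -/
def IsLeftNoetherian : Prop := WellFoundedGT (NonUnitalLeftIdeal R)

/-- Ascending chain condition on right ideals. -/
def IsRightNoetherian : Prop := WellFoundedGT (NonUnitalRightIdeal R)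

/-- Descending chain condition on left ideals. -/
def IsLeftArtinian : Prop := WellFoundedLT (NonUnitalLeftIdeal R)

/-- Descending chain condition on right ideals. -/
def IsRightArtinian : Prop := WellFoundedLT (NonUnitalRightIdeal R)

end RingProperties

/-! ### The Kronecker square of a quiver -/

/-- The vertex set of the Kronecker square of a quiver with vertex set `V`. -/
def KroneckerSquare (V : Type u) : Type u := V × V

/-- The arrows `[e, f]` of the Kronecker square are the pairs of arrows of the quiver, with
`s [e, f] = [s e, s f]` and `r [e, f] = [r e, r f]`. -/
instance KroneckerSquare.instQuiver (V : Type u) [Quiver.{v} V] :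
    Quiver.{v} (KroneckerSquare V) where
  Hom a b := (a.1 ⟶ b.1) × (a.2 ⟶ b.2)

/-! ### Leavitt path algebras -/

/-- The type of all arrows of a quiver; the arrow `⟨a, b, e⟩` has source `a` and range `b`. -/
abbrev QuiverArrow (V : Type u) [Quiver.{v} V] : Type (max u v) := Σ a b : V, (a ⟶ b)

/-- The source of an arrow. -/
abbrev QuiverArrow.s {V : Type u} [Quiver.{v} V] (e : QuiverArrow V) : V := e.1

/-- The range of an arrow. -/
abbrev QuiverArrow.r {V : Type u} [Quiver.{v} V] (e : QuiverArrow V) : V := e.2.1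

/-- The generators of the Leavitt path algebra: vertices, arrows and ghost arrows. -/
inductive LeavittGen (V : Type u) [Quiver.{v} V] : Type (max u v)
  | vertex (a : V) : LeavittGen V
  | arrow (e : QuiverArrow V) : LeavittGen V
  | ghost (e : QuiverArrow V) : LeavittGen V

section LeavittPathAlgebra

variable (K : Type w) [Field K] (V : Type u) [Quiver.{v} V]

/-- The free (non-unital) associative `K`-algebra on the generators, realised as the semigroup
algebra of the free semigroup. -/
abbrev LeavittFree : Type (max u v w) := MonoidAlgebra K (FreeSemigroup (LeavittGen V))

variable {V}

/-- A generator, as an element of the free algebra. -/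
noncomputable def LeavittFree.gen (x : LeavittGen V) : LeavittFree K V :=
  MonoidAlgebra.single (FreeSemigroup.of x) 1

/-- A vertex, as an element of the free algebra. -/
noncomputable abbrev LeavittFree.vertex (a : V) : LeavittFree K V := .gen K (.vertex a)

/-- An arrow `e`, as an element of the free algebra. -/
noncomputable abbrev LeavittFree.arrow (e : QuiverArrow V) : LeavittFree K V := .gen K (.arrow e)

/-- A ghost arrow `e*`, as an element of the free algebra. -/
noncomputable abbrev LeavittFree.ghost (e : QuiverArrow V) : LeavittFree K V := .gen K (.ghost e)

open LeavittFree in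
/-- The defining relations of the Leavitt path algebra. The arrows with source `a` form the type
`Quiver.Star a`, so that `a` is a regular vertex if and only if that type is finite and nonempty. -/
inductive LeavittRel : LeavittFree K V → LeavittFree K V → Prop
  | vertex_mul_self (a : V) : LeavittRel (vertex K a * vertex K a) (vertex K a)
  | vertex_mul_of_ne (a b : V) : a ≠ b → LeavittRel (vertex K a * vertex K b) 0
  | source_mul_arrow (e : QuiverArrow V) : LeavittRel (vertex K e.s * arrow K e) (arrow K e)
  | arrow_mul_range (e : QuiverArrow V) : LeavittRel (arrow K e * vertex K e.r) (arrow K e)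
  | range_mul_ghost (e : QuiverArrow V) : LeavittRel (vertex K e.r * ghost K e) (ghost K e)
  | ghost_mul_source (e : QuiverArrow V) : LeavittRel (ghost K e * vertex K e.s) (ghost K e)
  | ck1_self (e : QuiverArrow V) : LeavittRel (ghost K e * arrow K e) (vertex K e.r)
  | ck1_of_ne (e f : QuiverArrow V) : e ≠ f → LeavittRel (ghost K e * arrow K f) 0
  | ck2 (a : V) [Fintype (Quiver.Star a)] [Nonempty (Quiver.Star a)] :
      LeavittRel (vertex K a) (∑ e : Quiver.Star a, arrow K ⟨a, e⟩ * ghost K ⟨a, e⟩)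

/-- The least `K`-algebra congruence on the free algebra that contains the defining relations. -/
inductive LeavittEquiv : LeavittFree K V → LeavittFree K V → Prop
  | of {x y : LeavittFree K V} : LeavittRel K x y → LeavittEquiv x y
  | refl (x : LeavittFree K V) : LeavittEquiv x x
  | symm {x y : LeavittFree K V} : LeavittEquiv x y → LeavittEquiv y x
  | trans {x y z : LeavittFree K V} : LeavittEquiv x y → LeavittEquiv y z → LeavittEquiv x z
  | add {x y z t : LeavittFree K V} :
      LeavittEquiv x y → LeavittEquiv z t → LeavittEquiv (x + z) (y + t)
  | mul {x y z t : LeavittFree K V} :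
      LeavittEquiv x y → LeavittEquiv z t → LeavittEquiv (x * z) (y * t)
  | smul (k : K) {x y : LeavittFree K V} : LeavittEquiv x y → LeavittEquiv (k • x) (k • y)

variable (V)

/-- `LeavittEquiv` as a bundled ring congruence. -/
def leavittCon : RingCon (LeavittFree K V) where
  r := LeavittEquiv K
  iseqv := ⟨.refl, .symm, .trans⟩
  add' := .add
  mul' := .mul

/-- The Leavitt path algebra `L_K(Q)` of the quiver `Q` with vertex set `V`. It has an identity
only if `V` is finite. -/
def LeavittPathAlgebra : Type (max u v w) := (leavittCon K V).Quotient

noncomputable instance LeavittPathAlgebra.instNonUnitalRing :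
    NonUnitalRing (LeavittPathAlgebra K V) :=
  inferInstanceAs (NonUnitalRing (leavittCon K V).Quotient)

/-- The scalar multiplication of the Leavitt path algebra, induced by that of the free algebra. -/
noncomputable instance LeavittPathAlgebra.instModule : Module K (LeavittPathAlgebra K V) where
  smul k := Quotient.map (fun x : LeavittFree K V => k • x) fun _ _ h => LeavittEquiv.smul k h
  one_smul := by
    rintro ⟨x⟩
    exact congrArg (fun y : LeavittFree K V => (y : (leavittCon K V).Quotient)) (one_smul K x)
  mul_smul := by
    rintro k l ⟨x⟩
    exact congrArg (fun y : LeavittFree K V => (y : (leavittCon K V).Quotient)) (mul_smul k l x)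
  smul_zero k :=
    congrArg (fun y : LeavittFree K V => (y : (leavittCon K V).Quotient)) (smul_zero k)
  smul_add := by
    rintro k ⟨x⟩ ⟨y⟩
    exact congrArg (fun y : LeavittFree K V => (y : (leavittCon K V).Quotient)) (smul_add k x y)
  add_smul := by
    rintro k l ⟨x⟩
    exact congrArg (fun y : LeavittFree K V => (y : (leavittCon K V).Quotient)) (add_smul k l x)
  zero_smul := by
    rintro ⟨x⟩
    exact congrArg (fun y : LeavittFree K V => (y : (leavittCon K V).Quotient)) (zero_smul K x)

instance LeavittPathAlgebra.instIsScalarTower :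
    IsScalarTower K (LeavittPathAlgebra K V) (LeavittPathAlgebra K V) where
  smul_assoc := by
    rintro k ⟨x⟩ ⟨y⟩
    exact congrArg (fun y : LeavittFree K V => (y : (leavittCon K V).Quotient))
      (smul_mul_assoc k x y)

instance LeavittPathAlgebra.instSMulCommClass :
    SMulCommClass K (LeavittPathAlgebra K V) (LeavittPathAlgebra K V) where
  smul_comm := by
    rintro k ⟨x⟩ ⟨y⟩
    exact congrArg (fun y : LeavittFree K V => (y : (leavittCon K V).Quotient))
      (mul_smul_comm k x y).symm

end LeavittPathAlgebra

/-!
All five properties of `L_K(Q)` depend only on the quiver: the algebra is von Neumann regular if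
and only if `Q` is acyclic, noetherian if and only if `Q` is finite and no cycle of `Q` has an
exit, and artinian if and only if `Q` is finite and acyclic. Left and right do not differ, since
exchanging `e` and `e*` is an involution. Cycles of the square are pairs of closed paths of `Q`, so
each condition on the quiver passes from `Q` to its square and back.

Necessity: let `c` be a closed path of positive degree `n` at `a`. In Laurent polynomials `a - c`
becomes `a (1 - c T ^ n)`, whose inverse would be the infinite series `∑ c ^ k T ^ (k n)`; so
`a - c` has no generalized inverse, and the left multiples of the powers of `1 - c T ^ n` form a
strictly descending chain. Either chain condition forces families of orthogonal idempotents to be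
finite: the vertices, the `e e*`, and the `c ^ i f f* (c*) ^ i` for an exit `f` of `c`.

Sufficiency: if `Q` is acyclic, finitely many arrows and their ghosts lie in a direct product of
matrix algebras, with matrix units `p (b - ∑ e e*) q*`. If no cycle has an exit and `w` lies on a
cycle `c`, then `w L_K(Q)` is finitely generated over the commutative noetherian algebra generated
by `c` and `c*`; the remaining vertices reduce to such vertices and to sinks by relation (5).
-/

section ChainConditions

namespace NonUnitalLeftIdeal

variable {R : Type u} [NonUnitalRing R]

instance instSetLike : SetLike (NonUnitalLeftIdeal R) R where
  coe I := I.carrier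
  coe_injective I J h := by
    obtain ⟨⟨⟨⟨I, _⟩, _⟩, _⟩, _⟩ := I
    obtain ⟨⟨⟨⟨J, _⟩, _⟩, _⟩, _⟩ := J
    congr

instance instIsConcreteLE : IsConcreteLE (NonUnitalLeftIdeal R) R where
  coe_subset_coe' := Iff.rfl

instance instAddSubgroupClass : AddSubgroupClass (NonUnitalLeftIdeal R) R where
  add_mem {I} := I.add_mem'
  zero_mem I := I.zero_mem'
  neg_mem {I} := I.neg_mem'

/-- The left annihilator of a subset, as a left ideal. -/
def leftAnnihilator (s : Set R) : NonUnitalLeftIdeal R where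
  carrier := {x | ∀ y ∈ s, x * y = 0}
  zero_mem' _ _ := zero_mul _
  add_mem' hx hx' y hy := by rw [add_mul, hx y hy, hx' y hy, add_zero]
  neg_mem' hx y hy := by rw [neg_mul, hx y hy, neg_zero]
  mul_mem_left r x hx y hy := by rw [mul_assoc, hx y hy, mul_zero]

theorem mem_leftAnnihilator {s : Set R} {x : R} :
    x ∈ leftAnnihilator s ↔ ∀ y ∈ s, x * y = 0 := Iff.rfl

theorem mem_leftAnnihilator_image_compl_iff {ι : Type*} {e : ι → R} (he : ∀ i, e i * e i ≠ 0)
    (ho : Pairwise fun i j => e i * e j = 0) {s : Set ι} {i : ι} :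
    e i ∈ leftAnnihilator (e '' sᶜ) ↔ i ∈ s := by
  rw [mem_leftAnnihilator, Set.forall_mem_image]
  exact ⟨fun h => not_not.mp fun hi => he i (h hi),
    fun hi j hj => ho (by rintro rfl; exact hj hi)⟩

theorem strictMono_leftAnnihilator_image_compl {ι : Type*} {e : ι → R}
    (he : ∀ i, e i * e i ≠ 0) (ho : Pairwise fun i j => e i * e j = 0) :
    StrictMono fun s : Set ι => leftAnnihilator (e '' sᶜ) := by
  refine Monotone.strictMono_of_injective (fun s t hst x hx y hy => ?_) fun s t hst => ?_
  · exact hx y (Set.image_mono (Set.compl_subset_compl.mpr hst) hy)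
  · ext i
    rw [← mem_leftAnnihilator_image_compl_iff he ho, ← mem_leftAnnihilator_image_compl_iff he ho]
    exact SetLike.ext_iff.mp hst (e i)

/-- An involution exchanges left ideals and right ideals. -/
def starOrderIso [StarRing R] : NonUnitalLeftIdeal R ≃o NonUnitalRightIdeal R where
  toFun I :=
    { carrier := {x | star x ∈ I.carrier}
      zero_mem' := by simp
      add_mem' := fun hx hy => by simpa using I.add_mem' hx hy
      neg_mem' := fun hx => by simpa using I.neg_mem' hx
      mul_mem_right := fun r x hx => by simpa using I.mul_mem_left (star r) hx }
  invFun I :=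
    { carrier := {x | star x ∈ I.carrier}
      zero_mem' := by simp
      add_mem' := fun hx hy => by simpa using I.add_mem' hx hy
      neg_mem' := fun hx => by simpa using I.neg_mem' hx
      mul_mem_left := fun r x hx => by simpa using I.mul_mem_right (star r) hx }
  left_inv := by
    rintro ⟨⟨⟨⟨I, _⟩, _⟩, _⟩, _⟩
    simp
  right_inv := by
    rintro ⟨⟨⟨⟨I, _⟩, _⟩, _⟩, _⟩
    simp
  map_rel_iff' :=
    ⟨fun h x hx => by simpa using @h (star x) (by simpa using hx), fun h _ hx => h hx⟩

end NonUnitalLeftIdeal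

open NonUnitalLeftIdeal

variable {R : Type u} [NonUnitalRing R]

theorem finite_of_wellFoundedGT_set {ι : Type*} [WellFoundedGT (Set ι)] : Finite ι :=
  WellFoundedGT.finite_of_iSupIndep
    (iSupIndep_iff_pairwiseDisjoint.mpr fun _ _ h => Set.disjoint_singleton.mpr h)
    Set.singleton_ne_empty

theorem finite_of_wellFoundedLT_set {ι : Type*} [WellFoundedLT (Set ι)] : Finite ι :=
  WellFoundedLT.finite_of_iSupIndep
    (iSupIndep_iff_pairwiseDisjoint.mpr fun _ _ h => Set.disjoint_singleton.mpr h)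
    Set.singleton_ne_empty

theorem finite_of_orthogonal (h : IsLeftNoetherian R ∨ IsLeftArtinian R) {ι : Type*} {e : ι → R}
    (he : ∀ i, e i * e i ≠ 0) (ho : Pairwise fun i j => e i * e j = 0) : Finite ι := by
  have hmono := strictMono_leftAnnihilator_image_compl he ho
  obtain h | h := h
  · have : WellFoundedGT (NonUnitalLeftIdeal R) := h
    have := hmono.wellFoundedGT
    exact finite_of_wellFoundedGT_set
  · have : WellFoundedLT (NonUnitalLeftIdeal R) := h
    have := hmono.wellFoundedLT
    exact finite_of_wellFoundedLT_set

section Star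

variable [StarRing R]

theorem isRightNoetherian_iff_isLeftNoetherian : IsRightNoetherian R ↔ IsLeftNoetherian R :=
  ⟨fun h => @StrictMono.wellFoundedGT _ _ _ _ _ h starOrderIso.strictMono,
    fun h => @StrictMono.wellFoundedGT _ _ _ _ _ h starOrderIso.symm.strictMono⟩

theorem isRightArtinian_iff_isLeftArtinian : IsRightArtinian R ↔ IsLeftArtinian R :=
  ⟨fun h => @StrictMono.wellFoundedLT _ _ _ _ _ h starOrderIso.strictMono,
    fun h => @StrictMono.wellFoundedLT _ _ _ _ _ h starOrderIso.symm.strictMono⟩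

theorem finite_of_star_orthogonal (h : IsLeftNoetherian R ∨ IsLeftArtinian R) {ι : Type*}
    {x : ι → R} (hidem : ∀ i, IsIdempotentElem (star (x i) * x i))
    (hne : ∀ i, star (x i) * x i ≠ 0) (ho : Pairwise fun i j => star (x i) * x j = 0) :
    Finite ι := by
  refine finite_of_orthogonal h (e := fun i => x i * star (x i)) (fun i hi => hne i ?_)
    fun i j hij => ?_
  · calc star (x i) * x i = star (x i) * (x i * star (x i) * (x i * star (x i))) * x i := by
          simpa only [mul_assoc] using
            ((congrArg (· * (star (x i) * x i)) (hidem i)).trans (hidem i)).symm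
      _ = 0 := by rw [hi, mul_zero, zero_mul]
  · change x i * star (x i) * (x j * star (x j)) = 0
    rw [mul_assoc, ← mul_assoc (star (x i)), ho hij, zero_mul, mul_zero]

theorem star_iterate_mul_iterate_add {c f v : R} (hc : star c * c = v) (hvc : v * c = c)
    (hvf : v * f = f) (i k : ℕ) :
    star ((c * ·)^[i] f) * (c * ·)^[i + k] f = star f * (c * ·)^[k] f := by
  have hv (n : ℕ) : v * (c * ·)^[n] f = (c * ·)^[n] f := by
    cases n with
    | zero => exact hvf
    | succ n => rw [Function.iterate_succ_apply', ← mul_assoc, hvc]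
  induction i with
  | zero => rw [Nat.zero_add, Function.iterate_zero_apply]
  | succ i ih =>
    rw [Nat.add_right_comm, Function.iterate_succ_apply', Function.iterate_succ_apply', star_mul,
      mul_assoc, ← mul_assoc (star c), hc, hv, ih]

theorem pairwise_star_iterate_mul_iterate {c f v : R} (hc : star c * c = v) (hvc : v * c = c)
    (hvf : v * f = f) (hfc : star f * c = 0) :
    Pairwise fun i j => star ((c * ·)^[i] f) * (c * ·)^[j] f = 0 := by
  have hlt {i j : ℕ} (hij : i < j) : star ((c * ·)^[i] f) * (c * ·)^[j] f = 0 := by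
    obtain ⟨k, rfl⟩ := Nat.exists_eq_add_of_lt hij
    rw [Nat.add_assoc, star_iterate_mul_iterate_add hc hvc hvf, Function.iterate_succ_apply',
      ← mul_assoc, hfc, zero_mul]
  intro i j hij
  obtain h | h := hij.lt_or_gt
  · exact hlt h
  · simpa only [star_mul, star_star, star_zero] using congrArg star (hlt h)

end Star

section LeftChainsStabilize

/-- Every ascending chain of left ideals becomes stationary after left multiplication by `u`. This
localises the ascending chain condition: the elements with this property form a two-sided ideal. -/
def LeftChainsStabilize (u : R) : Prop :=
  ∀ I : ℕ →o NonUnitalLeftIdeal R, ∃ n, ∀ m, n ≤ m → ∀ x ∈ I m, u * x ∈ I n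

namespace LeftChainsStabilize

variable {u v : R}

theorem zero : LeftChainsStabilize (0 : R) := fun I =>
  ⟨0, fun _ _ x _ => by rw [zero_mul]; exact zero_mem (I 0)⟩

theorem add (hu : LeftChainsStabilize u) (hv : LeftChainsStabilize v) :
    LeftChainsStabilize (u + v) := by
  intro I
  obtain ⟨n, hn⟩ := hu I
  obtain ⟨k, hk⟩ := hv I
  refine ⟨max n k, fun m hm x hx => ?_⟩
  rw [add_mul]
  exact add_mem (I.monotone (le_max_left n k) (hn m (le_of_max_le_left hm) x hx))
    (I.monotone (le_max_right n k) (hk m (le_of_max_le_right hm) x hx))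

theorem sum {ι : Type*} {s : Finset ι} {f : ι → R} (h : ∀ i ∈ s, LeftChainsStabilize (f i)) :
    LeftChainsStabilize (∑ i ∈ s, f i) :=
  Finset.sum_induction f LeftChainsStabilize (fun _ _ => add) zero h

theorem mul_left (hu : LeftChainsStabilize u) (r : R) : LeftChainsStabilize (r * u) := fun I =>
  (hu I).imp fun n hn m hm x hx => by
    rw [mul_assoc]
    exact (I n).mul_mem_left r (hn m hm x hx)

theorem mul_right (hu : LeftChainsStabilize u) (r : R) : LeftChainsStabilize (u * r) := fun I =>
  (hu I).imp fun n hn m hm x hx => by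
    rw [mul_assoc]
    exact hn m hm _ ((I m).mul_mem_left r hx)

theorem isLeftNoetherian (h : LeftChainsStabilize u) (hu : ∀ x, u * x = x) :
    IsLeftNoetherian R :=
  wellFoundedGT_iff_monotone_chain_condition.mpr fun I =>
    (h I).imp fun _ hn m hm => le_antisymm (I.monotone hm) fun x hx => hu x ▸ hn m hm x hx

end LeftChainsStabilize

variable (K : Type*) [CommRing K] [Module K R] [SMulCommClass K R R]

/-- The subalgebra of the linear endomorphisms of `R` generated by the left multiplications by the
elements of `s`. Left ideals are modules over it, and it is noetherian in cases where `R` is not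
known to be. -/
noncomputable abbrev leftMulAdjoin (s : Set R) : Subalgebra K (Module.End K R) :=
  Algebra.adjoin K (LinearMap.mulLeft K '' s)

open scoped IsMulCommutative in
theorem isNoetherianRing_leftMulAdjoin [IsNoetherianRing K] {s : Set R} (hs : s.Finite)
    (hcomm : ∀ a ∈ s, ∀ b ∈ s, a * b = b * a) : IsNoetherianRing (leftMulAdjoin K s) := by
  have hcomm' : ∀ f ∈ LinearMap.mulLeft K '' s, ∀ g ∈ LinearMap.mulLeft K '' s, f * g = g * f := by
    rintro _ ⟨a, ha, rfl⟩ _ ⟨b, hb, rfl⟩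
    rw [Module.End.mul_eq_comp, Module.End.mul_eq_comp, ← LinearMap.mulLeft_mul,
      ← LinearMap.mulLeft_mul, hcomm a ha b hb]
  have : IsMulCommutative (leftMulAdjoin K s) := Algebra.isMulCommutative_adjoin K hcomm'
  have : Algebra.FiniteType K (leftMulAdjoin K s) :=
    (Subalgebra.fg_iff_finiteType _).mp (Subalgebra.fg_def.mpr ⟨_, hs.image _, rfl⟩)
  exact Algebra.FiniteType.isNoetherianRing K (leftMulAdjoin K s)

variable {K} in
theorem mul_mem_of_mem_leftMulAdjoin {s : Set R} (N : Submodule (leftMulAdjoin K s) R) {a x : R}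
    (ha : a ∈ s) (hx : x ∈ N) : a * x ∈ N :=
  N.smul_mem ⟨LinearMap.mulLeft K a, Algebra.subset_adjoin (Set.mem_image_of_mem _ ha)⟩ hx

variable [IsScalarTower K R R] {u : R} (hu : ∀ x, u * x = x)

namespace NonUnitalLeftIdeal

include hu

omit [SMulCommClass K R R] in
variable {K} in
theorem smul_mem_of_left_identity (I : NonUnitalLeftIdeal R) (k : K) {x : R} (hx : x ∈ I) :
    k • x ∈ I := by
  rw [← hu x, ← smul_mul_assoc]
  exact I.mul_mem_left _ hx

/-- In the presence of a left identity `u`, a left ideal is a module over `leftMulAdjoin K s`. -/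
def toSubmodule (s : Set R) : NonUnitalLeftIdeal R ↪o Submodule (leftMulAdjoin K s) R where
  toFun I :=
    { I.toAddSubgroup with
      smul_mem' := by
        rintro ⟨f, hf⟩ x hx
        change f x ∈ I
        induction hf using Algebra.adjoin_induction generalizing x with
        | mem _ hmem =>
          obtain ⟨a, -, rfl⟩ := hmem
          exact I.mul_mem_left a hx
        | algebraMap k => exact smul_mem_of_left_identity hu I k hx
        | add _ _ _ _ hf hg => exact add_mem (hf hx) (hg hx)
        | mul _ _ _ _ hf hg => exact hf (hg hx) }
  inj' I J h := SetLike.ext fun x => SetLike.ext_iff.mp h x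
  map_rel_iff' := Iff.rfl

end NonUnitalLeftIdeal

include hu

theorem isLeftArtinian_of_isArtinian [IsArtinian K R] : IsLeftArtinian R :=
  have : IsArtinian (leftMulAdjoin K (Set.univ : Set R)) R := isArtinian_of_tower K ‹_›
  (NonUnitalLeftIdeal.toSubmodule K hu Set.univ).strictMono.wellFoundedLT

variable {K} in
theorem LeftChainsStabilize.of_fg [IsNoetherianRing K] {s : Set R} (hs : s.Finite)
    (hcomm : ∀ a ∈ s, ∀ b ∈ s, a * b = b * a) {N : Submodule (leftMulAdjoin K s) R} (hN : N.FG)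
    {w : R} (hw : ∀ x, w * x ∈ N) : LeftChainsStabilize w := by
  intro I
  have := isNoetherianRing_leftMulAdjoin K hs hcomm
  have := isNoetherian_of_fg_of_noetherian N hN
  obtain ⟨n, hn⟩ := monotone_stabilizes_iff_noetherian.mpr this
    ⟨fun n => (NonUnitalLeftIdeal.toSubmodule K hu s (I n)).comap N.subtype,
      fun i j hij x hx => I.monotone hij hx⟩
  refine ⟨n, fun m hm x hx => ?_⟩
  have hmem : (⟨w * x, hw x⟩ : N) ∈
      (NonUnitalLeftIdeal.toSubmodule K hu s (I m)).comap N.subtype := (I m).mul_mem_left _ hx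
  exact (hn m hm).symm.le hmem

end LeftChainsStabilize

end ChainConditions

section GeneralizedInverses

theorem exists_linearMap_comp_comp_eq {K M N : Type*} [DivisionRing K] [AddCommGroup M]
    [Module K M] [AddCommGroup N] [Module K N] (f : M →ₗ[K] N) :
    ∃ g : N →ₗ[K] M, f ∘ₗ g ∘ₗ f = f := by
  obtain ⟨s, hs⟩ := f.rangeRestrict.exists_rightInverse_of_surjective f.range_rangeRestrict
  obtain ⟨p, hp⟩ := (LinearMap.range f).subtype.exists_leftInverse_of_injective
    (LinearMap.range f).ker_subtype
  refine ⟨s ∘ₗ p, LinearMap.ext fun x => ?_⟩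
  have hpf : p (f x) = f.rangeRestrict x := LinearMap.congr_fun hp (f.rangeRestrict x)
  have hsf : f.rangeRestrict (s (f.rangeRestrict x)) = f.rangeRestrict x :=
    LinearMap.congr_fun hs (f.rangeRestrict x)
  change f (s (p (f x))) = f x
  rw [hpf]
  exact congrArg Subtype.val hsf

theorem exists_matrix_mul_mul_eq {K m n : Type*} [Field K] [Fintype m] [Fintype n]
    (A : Matrix m n K) : ∃ B : Matrix n m K, A * B * A = A := by
  classical
  obtain ⟨g, hg⟩ := exists_linearMap_comp_comp_eq (Matrix.toLin' A)
  refine ⟨LinearMap.toMatrix' g, Matrix.toLin'.injective ?_⟩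
  rw [Matrix.mul_assoc, Matrix.toLin'_mul, Matrix.toLin'_mul, Matrix.toLin'_toMatrix', hg]

theorem sum_mul_sum_of_orthogonal {R ι : Type*} [NonUnitalNonAssocSemiring R] {s : Finset ι}
    {x y : ι → R} (h : ∀ i j, i ≠ j → x i * y j = 0) :
    (∑ i ∈ s, x i) * ∑ i ∈ s, y i = ∑ i ∈ s, x i * y i := by
  rw [Finset.sum_mul_sum]
  exact Finset.sum_congr rfl fun i hi =>
    Finset.sum_eq_single_of_mem i hi fun j _ hj => h i j hj.symm

/-- The multiplication rules of a system of matrix units indexed by `ι`. -/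
structure IsMatrixUnits {R ι : Type*} [Mul R] [Zero R] (E : ι → ι → R) : Prop where
  mul_eq (i j k : ι) : E i j * E j k = E i k
  mul_eq_zero (i : ι) {j k : ι} (l : ι) : j ≠ k → E i j * E k l = 0

variable (K : Type*) {R ι : Type*} [Field K] [NonUnitalRing R] [Module K R] [Fintype ι]
  [DecidableEq ι]

/-- The linear map that sends the standard matrix units to `E`. -/
noncomputable def matrixUnitsLift (E : ι → ι → R) : Matrix ι ι K →ₗ[K] R :=
  Matrix.liftLinear K fun i j => LinearMap.toSpanSingleton K R (E i j)

theorem matrixUnitsLift_single (E : ι → ι → R) (i j : ι) (k : K) :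
    matrixUnitsLift K E (Matrix.single i j k) = k • E i j :=
  Matrix.liftLinear_single K (fun i j => LinearMap.toSpanSingleton K R (E i j)) i j k

variable [IsScalarTower K R R] [SMulCommClass K R R]

variable {K} in
theorem matrixUnitsLift_mul_eq_zero {κ : Type*} [Fintype κ] [DecidableEq κ] {E : ι → ι → R}
    {F : κ → κ → R}
    (h : ∀ i j k l, E i j * F k l = 0) (A : Matrix ι ι K) (B : Matrix κ κ K) :
    matrixUnitsLift K E A * matrixUnitsLift K F B = 0 := by
  induction A using Matrix.induction_on' with
  | h_zero => simp
  | h_add A A' hA hA' => rw [map_add, add_mul, hA, hA', add_zero]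
  | h_std_basis i j x =>
    induction B using Matrix.induction_on' with
    | h_zero => simp
    | h_add B B' hB hB' => rw [map_add, mul_add, hB, hB', add_zero]
    | h_std_basis k l y =>
      rw [matrixUnitsLift_single, matrixUnitsLift_single, smul_mul_smul_comm, h, smul_zero]

variable {K} in
theorem IsMatrixUnits.lift_mul {E : ι → ι → R} (hE : IsMatrixUnits E) (A B : Matrix ι ι K) :
    matrixUnitsLift K E (A * B) = matrixUnitsLift K E A * matrixUnitsLift K E B := by
  induction A using Matrix.induction_on' with
  | h_zero => simp
  | h_add A A' hA hA' => rw [Matrix.add_mul, map_add, map_add, add_mul, hA, hA']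
  | h_std_basis i j x =>
    induction B using Matrix.induction_on' with
    | h_zero => simp
    | h_add B B' hB hB' => rw [Matrix.mul_add, map_add, map_add, mul_add, hB, hB']
    | h_std_basis k l y =>
      rw [matrixUnitsLift_single, matrixUnitsLift_single, smul_mul_smul_comm]
      obtain rfl | hjk := eq_or_ne j k
      · rw [Matrix.single_mul_single_same, matrixUnitsLift_single, hE.mul_eq]
      · rw [Matrix.single_mul_single_of_ne _ _ _ _ hjk, map_zero, hE.mul_eq_zero _ _ hjk,
          smul_zero]

theorem exists_mul_mul_eq_of_mem_span_matrixUnits {B : Type*} {ι : B → Type*} [∀ b, Finite (ι b)]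
    {E : ∀ b, ι b → ι b → R} (hE : ∀ b, IsMatrixUnits (E b))
    (ho : ∀ b c, b ≠ c → ∀ i j k l, E b i j * E c k l = 0) {x : R}
    (hx : x ∈ Submodule.span K {y | ∃ b i j, E b i j = y}) : ∃ y, x * y * x = x := by
  classical
  have (b : B) : Fintype (ι b) := Fintype.ofFinite (ι b)
  have hspan : Submodule.span K {y | ∃ b i j, E b i j = y} ≤
      ⨆ b, LinearMap.range (matrixUnitsLift K (E b)) := by
    refine Submodule.span_le.mpr ?_
    rintro _ ⟨b, i, j, rfl⟩
    exact Submodule.mem_iSup_of_mem b ⟨Matrix.single i j 1, by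
      rw [matrixUnitsLift_single, one_smul]⟩
  obtain ⟨f, hf, rfl⟩ := (Submodule.mem_iSup_iff_exists_finsupp _ x).mp (hspan hx)
  choose A hA using hf
  choose A' hA' using fun b => exists_matrix_mul_mul_eq (A b)
  have horth (C C' : ∀ b, Matrix (ι b) (ι b) K) (b c : B) (hbc : b ≠ c) :
      matrixUnitsLift K (E b) (C b) * matrixUnitsLift K (E c) (C' c) = 0 :=
    matrixUnitsLift_mul_eq_zero (ho b c hbc) _ _
  refine ⟨∑ b ∈ f.support, matrixUnitsLift K (E b) (A' b), ?_⟩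
  simp only [Finsupp.sum, ← hA]
  rw [sum_mul_sum_of_orthogonal (horth A A')]
  simp only [← (hE _).lift_mul]
  rw [sum_mul_sum_of_orthogonal (horth (fun b => A b * A' b) A)]
  simp only [← (hE _).lift_mul, hA']

end GeneralizedInverses

section LaurentPolynomials

open LaurentPolynomial AddMonoidAlgebra

theorem eq_zero_of_lt_of_forall_sub {M : Type*} [Zero M] (f : ℤ →₀ M) {n b : ℤ} (hn : 0 < n)
    (h : ∀ j < b, f (j - n) = 0 → f j = 0) : ∀ j < b, f j = 0 := by
  by_contra! hf
  obtain ⟨j, hj, hmin⟩ := (f.support.filter (· < b)).exists_minimal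
    (by obtain ⟨j, hjb, hj⟩ := hf; exact ⟨j, by simp [hjb, hj]⟩)
  simp only [Finset.mem_filter, Finsupp.mem_support_iff] at hj hmin
  refine hj.1 (h j hj.2 ?_)
  by_contra hne
  have := hmin ⟨hne, by lia⟩ (by lia)
  lia

variable {A : Type*} [Ring A] {c : A} {n : ℤ}

theorem coeff_mul_one_sub_single (y : A[T;T⁻¹]) (j : ℤ) :
    (y * (1 - single n c)).coeff j = y.coeff j - y.coeff (j - n) * c := by
  rw [mul_sub, mul_one, AddMonoidAlgebra.coeff_sub, Finsupp.sub_apply,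
    AddMonoidAlgebra.coeff_mul_single_apply, sub_eq_add_neg j]

theorem coeff_one_sub_single_mul (y : A[T;T⁻¹]) (j : ℤ) :
    ((1 - single n c) * y).coeff j = y.coeff j - c * y.coeff (j - n) := by
  rw [sub_mul, one_mul, AddMonoidAlgebra.coeff_sub, Finsupp.sub_apply,
    AddMonoidAlgebra.coeff_single_mul_apply, neg_add_eq_sub]

theorem isLeftRegular_one_sub_single (hn : 0 < n) :
    IsLeftRegular (1 - single n c : A[T;T⁻¹]) := by
  refine isLeftRegular_iff_right_eq_zero_of_mul.mpr fun y hy => LaurentPolynomial.ext fun j => ?_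
  refine eq_zero_of_lt_of_forall_sub y.coeff hn (fun j _ hj => ?_) j (lt_add_one j)
  have hyj := DFunLike.congr_fun (congrArg AddMonoidAlgebra.coeff hy) j
  rwa [coeff_one_sub_single_mul, hj, mul_zero, sub_zero] at hyj

theorem isRightRegular_one_sub_single (hn : 0 < n) :
    IsRightRegular (1 - single n c : A[T;T⁻¹]) := by
  refine isRightRegular_iff_left_eq_zero_of_mul.mpr fun y hy => LaurentPolynomial.ext fun j => ?_
  refine eq_zero_of_lt_of_forall_sub y.coeff hn (fun j _ hj => ?_) j (lt_add_one j)
  have hyj := DFunLike.congr_fun (congrArg AddMonoidAlgebra.coeff hy) j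
  rwa [coeff_mul_one_sub_single, hj, zero_mul, sub_zero] at hyj

/- Only the formal power series `∑ v c ^ k T ^ (k n)` can solve the equation, so it must be
a polynomial. -/
theorem exists_mul_pow_eq_zero_of_mul_one_sub_single_eq (hn : 0 < n) {v : A} {y : A[T;T⁻¹]}
    (h : y * (1 - single n c) = single 0 v) : ∃ k : ℕ, v * c ^ k = 0 := by
  have hrec (j : ℤ) : y.coeff j - y.coeff (j - n) * c = (single 0 v : A[T;T⁻¹]).coeff j := by
    rw [← h, coeff_mul_one_sub_single]
  have hne {j : ℤ} (hj : j ≠ 0) (hjn : y.coeff (j - n) * c = 0) : y.coeff j = 0 := by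
    have hrec_j := hrec j
    rwa [hjn, sub_zero, coeff_single, Finsupp.single_eq_of_ne hj] at hrec_j
  have hneg : ∀ j < 0, y.coeff j = 0 := eq_zero_of_lt_of_forall_sub y.coeff hn fun j hj hjn =>
    hne hj.ne (by rw [hjn, zero_mul])
  have hpow (k : ℕ) : y.coeff (k * n) = v * c ^ k := by
    induction k with
    | zero =>
      have h0 := hrec 0
      rw [hneg (0 - n) (by lia), zero_mul, sub_zero, coeff_single, Finsupp.single_eq_same] at h0
      rw [Nat.cast_zero, zero_mul, h0, pow_zero, mul_one]
    | succ k ih =>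
      have hk := hrec ((k + 1 : ℕ) * n)
      rw [coeff_single, Finsupp.single_eq_of_ne (by positivity), sub_eq_zero, Nat.cast_succ,
        add_one_mul, add_sub_cancel_right, ih] at hk
      rw [Nat.cast_succ, add_one_mul, hk, pow_succ, mul_assoc]
  have hinj : Function.Injective fun k : ℕ => (k : ℤ) * n :=
    (mul_left_injective₀ hn.ne').comp Nat.cast_injective
  obtain ⟨k, hk⟩ :=
    Infinite.exists_notMem_finset (y.coeff.support.preimage (fun k : ℕ => (k : ℤ) * n) hinj.injOn)
  rw [Finset.mem_preimage, Finsupp.notMem_support_iff, hpow] at hk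
  exact ⟨k, hk⟩

variable {R : Type*} [NonUnitalRing R] (φ : R →ₙ+* A[T;T⁻¹]) {v : A} {x y : R}

theorem not_isVonNeumannRegular_of_single (hn : 0 < n) (hx : φ x = single 0 v)
    (hy : φ y = single n c) (hxy : x * y = y) (hyx : y * x = y) (hv : ∀ k : ℕ, v * c ^ k ≠ 0) :
    ¬ IsVonNeumannRegular R := by
  intro h
  obtain ⟨z, hz⟩ := h (x - y)
  have hleft : φ (x - y) = (1 - single n c) * φ x := by
    rw [map_sub, ← hy, sub_mul, one_mul, ← map_mul, hyx]
  have hright : φ (x - y) = φ x * (1 - single n c) := by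
    rw [map_sub, ← hy, mul_sub, mul_one, ← map_mul, hxy]
  have hcancel : φ x * φ z * φ x * (1 - single n c) = φ x := by
    refine isLeftRegular_one_sub_single (c := c) hn ?_
    calc (1 - single n c) * (φ x * φ z * φ x * (1 - single n c))
        = φ (x - y) * φ z * φ (x - y) := by
          nth_rw 2 [hright]
          rw [hleft]
          simp only [mul_assoc]
      _ = (1 - single n c) * φ x := by rw [← map_mul, ← map_mul, hz, hleft]
  obtain ⟨k, hk⟩ := exists_mul_pow_eq_zero_of_mul_one_sub_single_eq hn (hcancel.trans hx)
  exact hv k hk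

/-- The elements whose image under `φ` is a left multiple of `p`, as a left ideal. -/
def comapLeftMultiples {S : Type*} [Ring S] (φ : R →ₙ+* S) (p : S) : NonUnitalLeftIdeal R where
  carrier := {r | ∃ s, s * p = φ r}
  zero_mem' := ⟨0, by rw [zero_mul, map_zero]⟩
  add_mem' := by
    rintro a b ⟨s, hs⟩ ⟨t, ht⟩
    exact ⟨s + t, by rw [add_mul, hs, ht, map_add]⟩
  neg_mem' := by
    rintro a ⟨s, hs⟩
    exact ⟨-s, by rw [neg_mul, hs, map_neg]⟩
  mul_mem_left := by
    rintro r a ⟨s, hs⟩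
    exact ⟨φ r * s, by rw [mul_assoc, hs, map_mul]⟩

theorem map_iterate_sub_mul (hy : φ y = single n c) (k : ℕ) :
    φ ((fun z => z - z * y)^[k] x) = φ x * (1 - single n c) ^ k := by
  induction k with
  | zero => rw [Function.iterate_zero_apply, pow_zero, mul_one]
  | succ k ih =>
    rw [Function.iterate_succ_apply', map_sub, map_mul, ih, hy, pow_succ, ← mul_assoc,
      mul_one_sub]

theorem not_isLeftArtinian_of_single (hn : 0 < n) (hx : φ x = single 0 v)
    (hy : φ y = single n c) (hv : ∀ k : ℕ, v * c ^ k ≠ 0) : ¬ IsLeftArtinian R := by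
  intro (h : WellFoundedLT (NonUnitalLeftIdeal R))
  let p : A[T;T⁻¹] := 1 - single n c
  refine not_strictAnti_of_wellFoundedLT (fun k : ℕ => comapLeftMultiples φ (p ^ k))
    (strictAnti_nat_of_succ_lt fun k => lt_of_le_not_ge ?_ fun hle => ?_)
  · rintro r ⟨s, hs⟩
    exact ⟨s * p, by rw [mul_assoc, ← pow_succ', hs]⟩
  · obtain ⟨s, hs⟩ := hle ⟨φ x, (map_iterate_sub_mul (x := x) φ hy k).symm⟩
    rw [map_iterate_sub_mul φ hy, pow_succ', ← mul_assoc] at hs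
    obtain ⟨m, hm⟩ := exists_mul_pow_eq_zero_of_mul_one_sub_single_eq hn
      (((isRightRegular_one_sub_single hn).pow k hs).trans hx)
    exact hv m hm

end LaurentPolynomials

/-! ### The Leavitt path algebra: universal property and involution -/

namespace LeavittPathAlgebra

variable (K : Type w) [Field K] {V : Type u} [Quiver.{v} V]

/-- The quotient map from the free algebra to the Leavitt path algebra. -/
noncomputable def mk : LeavittFree K V →ₙₐ[K] LeavittPathAlgebra K V where
  toFun x := (x : (leavittCon K V).Quotient)
  map_smul' _ _ := rfl
  map_zero' := rfl
  map_add' _ _ := rfl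
  map_mul' _ _ := rfl

variable {K}

theorem mk_surjective : Function.Surjective (mk K : LeavittFree K V → LeavittPathAlgebra K V) :=
  Quotient.exists_rep

variable (K)

/-- A generator, as an element of the Leavitt path algebra. -/
noncomputable def gen (x : LeavittGen V) : LeavittPathAlgebra K V := mk K (LeavittFree.gen K x)

/-- A vertex, as an element of the Leavitt path algebra. -/
noncomputable def vertex (a : V) : LeavittPathAlgebra K V := gen K (.vertex a)

/-- An arrow, as an element of the Leavitt path algebra. -/
noncomputable def arrow (e : QuiverArrow V) : LeavittPathAlgebra K V := gen K (.arrow e)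

/-- A ghost arrow, as an element of the Leavitt path algebra. -/
noncomputable def ghost (e : QuiverArrow V) : LeavittPathAlgebra K V := gen K (.ghost e)

variable {K}

section Relations

theorem mk_eq_of_rel {x y : LeavittFree K V} (h : LeavittRel K x y) : mk K x = mk K y :=
  Quotient.sound (LeavittEquiv.of h)

theorem vertex_mul_self (a : V) : vertex K a * vertex K a = vertex K a :=
  (map_mul (mk K) _ _).symm.trans (mk_eq_of_rel (.vertex_mul_self a))

theorem vertex_mul_of_ne {a b : V} (h : a ≠ b) : vertex K a * vertex K b = 0 :=
  (map_mul (mk K) _ _).symm.trans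
    ((mk_eq_of_rel (.vertex_mul_of_ne a b h)).trans (map_zero (mk K)))

theorem source_mul_arrow (e : QuiverArrow V) : vertex K e.s * arrow K e = arrow K e :=
  (map_mul (mk K) _ _).symm.trans (mk_eq_of_rel (.source_mul_arrow e))

theorem arrow_mul_range (e : QuiverArrow V) : arrow K e * vertex K e.r = arrow K e :=
  (map_mul (mk K) _ _).symm.trans (mk_eq_of_rel (.arrow_mul_range e))

theorem range_mul_ghost (e : QuiverArrow V) : vertex K e.r * ghost K e = ghost K e :=
  (map_mul (mk K) _ _).symm.trans (mk_eq_of_rel (.range_mul_ghost e))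

theorem ghost_mul_source (e : QuiverArrow V) : ghost K e * vertex K e.s = ghost K e :=
  (map_mul (mk K) _ _).symm.trans (mk_eq_of_rel (.ghost_mul_source e))

theorem ghost_mul_arrow_self (e : QuiverArrow V) : ghost K e * arrow K e = vertex K e.r :=
  (map_mul (mk K) _ _).symm.trans (mk_eq_of_rel (.ck1_self e))

theorem ghost_mul_arrow_of_ne {e f : QuiverArrow V} (h : e ≠ f) : ghost K e * arrow K f = 0 :=
  (map_mul (mk K) _ _).symm.trans ((mk_eq_of_rel (.ck1_of_ne e f h)).trans (map_zero (mk K)))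

theorem vertex_eq_sum (a : V) [Fintype (Quiver.Star a)] [Nonempty (Quiver.Star a)] :
    vertex K a = ∑ e : Quiver.Star a, arrow K ⟨a, e⟩ * ghost K ⟨a, e⟩ :=
  (mk_eq_of_rel (.ck2 a)).trans
    ((map_sum (mk K) _ _).trans (Finset.sum_congr rfl fun _ _ => map_mul (mk K) _ _))

theorem vertex_mul_arrow_of_ne {a : V} {e : QuiverArrow V} (h : a ≠ e.s) :
    vertex K a * arrow K e = 0 := by
  rw [← source_mul_arrow, ← mul_assoc, vertex_mul_of_ne h, zero_mul]

end Relations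

@[elab_as_elim]
theorem induction_words {p : LeavittPathAlgebra K V → Prop} (zero : p 0)
    (add : ∀ x y, p x → p y → p (x + y)) (smul : ∀ (k : K) x, p x → p (k • x))
    (base : ∀ g, p (gen K g)) (gen_mul : ∀ g x, p x → p (gen K g * x))
    (x : LeavittPathAlgebra K V) : p x := by
  obtain ⟨x, rfl⟩ := mk_surjective x
  induction x using MonoidAlgebra.induction_linear with
  | zero => rwa [map_zero]
  | add x y hx hy =>
    rw [map_add]
    exact add _ _ hx hy
  | single w k =>
    have hword (w : FreeSemigroup (LeavittGen V)) : p (mk K (MonoidAlgebra.single w 1)) := by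
      induction w with
      | ih1 g => exact base g
      | ih2 g w _ hw =>
        have hmul : (MonoidAlgebra.single (FreeSemigroup.of g * w) 1 : LeavittFree K V) =
            LeavittFree.gen K g * MonoidAlgebra.single w 1 := by
          rw [LeavittFree.gen, MonoidAlgebra.single_mul_single, mul_one]
        rw [hmul, map_mul]
        exact gen_mul g _ hw
    rw [← mul_one k, ← MonoidAlgebra.smul_single', map_smul]
    exact smul k _ (hword w)

section Lift

variable {A : Type*} [NonUnitalRing A] [Module K A] [IsScalarTower K A A] [SMulCommClass K A A]

/-- The algebra homomorphism out of the free algebra with prescribed values on generators. -/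
noncomputable def freeLift (f : LeavittGen V → A) : LeavittFree K V →ₙₐ[K] A :=
  MonoidAlgebra.liftMagma K (FreeSemigroup.lift f)

@[simp]
theorem freeLift_gen (f : LeavittGen V → A) (g : LeavittGen V) :
    freeLift f (LeavittFree.gen K g) = f g := by
  simp [freeLift, LeavittFree.gen]

theorem freeLift_eq_of_equiv {f : LeavittGen V → A}
    (hf : ∀ x y : LeavittFree K V, LeavittRel K x y → freeLift f x = freeLift f y)
    {x y : LeavittFree K V} (h : LeavittEquiv K x y) : freeLift f x = freeLift f y := by
  induction h with
  | of h => exact hf _ _ h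
  | refl => rfl
  | symm _ h => exact h.symm
  | trans _ _ h₁ h₂ => exact h₁.trans h₂
  | add _ _ h₁ h₂ => rw [map_add, map_add, h₁, h₂]
  | mul _ _ h₁ h₂ => rw [map_mul, map_mul, h₁, h₂]
  | smul k _ h => rw [map_smul, map_smul, h]

/-- The algebra homomorphism out of the Leavitt path algebra given by values on the generators that
satisfy the defining relations. -/
noncomputable def lift (f : LeavittGen V → A)
    (hf : ∀ x y : LeavittFree K V, LeavittRel K x y → freeLift f x = freeLift f y) :
    LeavittPathAlgebra K V →ₙₐ[K] A where
  toFun := Quotient.lift (freeLift f) fun _ _ h => freeLift_eq_of_equiv hf h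
  map_smul' := by
    rintro k ⟨x⟩
    exact map_smul (freeLift f) k x
  map_zero' := map_zero (freeLift f)
  map_add' := by
    rintro ⟨x⟩ ⟨y⟩
    exact map_add (freeLift f) x y
  map_mul' := by
    rintro ⟨x⟩ ⟨y⟩
    exact map_mul (freeLift f) x y

theorem lift_gen (f : LeavittGen V → A)
    (hf : ∀ x y : LeavittFree K V, LeavittRel K x y → freeLift f x = freeLift f y)
    (g : LeavittGen V) : lift f hf (gen K g) = f g :=
  freeLift_gen f g

end Lift

section Involution

open MulOpposite

variable (K V) in
/-- The involution of the Leavitt path algebra, which exchanges arrows and ghost arrows, as a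
homomorphism to the opposite algebra. -/
noncomputable def starHom : LeavittPathAlgebra K V →ₙₐ[K] (LeavittPathAlgebra K V)ᵐᵒᵖ :=
  lift (fun g => match g with
    | .vertex a => op (vertex K a)
    | .arrow e => op (ghost K e)
    | .ghost e => op (arrow K e)) <| by
    rintro _ _ (a | ⟨a, b, h⟩ | e | e | e | e | e | ⟨e, f, h⟩ | @⟨a, _, _⟩)
    · simp [← op_mul, vertex_mul_self]
    · simp [← op_mul, vertex_mul_of_ne h.symm]
    · simp [← op_mul, ghost_mul_source]
    · simp [← op_mul, range_mul_ghost]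
    · simp [← op_mul, arrow_mul_range]
    · simp [← op_mul, source_mul_arrow]
    · simp [← op_mul, ghost_mul_arrow_self]
    · simp [← op_mul, ghost_mul_arrow_of_ne h.symm]
    · simp [← op_mul, vertex_eq_sum a]

theorem starHom_vertex (a : V) : starHom K V (vertex K a) = op (vertex K a) := lift_gen _ _ _

theorem starHom_arrow (e : QuiverArrow V) : starHom K V (arrow K e) = op (ghost K e) :=
  lift_gen _ _ _

theorem starHom_ghost (e : QuiverArrow V) : starHom K V (ghost K e) = op (arrow K e) :=
  lift_gen _ _ _

theorem starHom_starHom_gen (g : LeavittGen V) :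
    starHom K V (unop (starHom K V (gen K g))) = op (gen K g) := by
  obtain a | e | e := g
  · exact (congrArg (starHom K V ·.unop) (starHom_vertex a)).trans (starHom_vertex a)
  · exact (congrArg (starHom K V ·.unop) (starHom_arrow e)).trans (starHom_ghost e)
  · exact (congrArg (starHom K V ·.unop) (starHom_ghost e)).trans (starHom_arrow e)

theorem starHom_starHom (x : LeavittPathAlgebra K V) :
    starHom K V (unop (starHom K V x)) = op x := by
  induction x using induction_words with
  | zero => rw [map_zero, unop_zero, map_zero, op_zero]
  | add x y hx hy => rw [map_add, unop_add, map_add, hx, hy, op_add]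
  | smul k x hx => rw [map_smul, unop_smul, map_smul, hx, op_smul]
  | base g => exact starHom_starHom_gen g
  | gen_mul g x hx =>
    rw [map_mul, unop_mul, map_mul, hx, starHom_starHom_gen, op_mul]

noncomputable instance instStarRing : StarRing (LeavittPathAlgebra K V) where
  star x := unop (starHom K V x)
  star_involutive x := congrArg unop (starHom_starHom x)
  star_mul x y := by rw [map_mul, unop_mul]
  star_add x y := by rw [map_add, unop_add]

theorem star_vertex (a : V) : star (vertex K a) = vertex K a := congrArg unop (starHom_vertex a)

theorem star_arrow (e : QuiverArrow V) : star (arrow K e) = ghost K e :=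
  congrArg unop (starHom_arrow e)

end Involution

end LeavittPathAlgebra

/-! ### Paths -/

section Paths

variable {V : Type u} [Quiver.{v} V]

namespace QuiverArrow

/-- The source of the list of arrows `l`, regarded as a path that ends at `b`. -/
def source : List (QuiverArrow V) → V → V
  | [], b => b
  | e :: _, _ => e.s

/-- The list of arrows `l` is a path that ends at `b`. The end is recorded separately, since it is
not determined by the empty list. -/
def IsPath : List (QuiverArrow V) → V → Prop
  | [], _ => True
  | e :: l, b => e.r = source l b ∧ IsPath l b

@[simp]
theorem source_nil (b : V) : source [] b = b := rfl

@[simp]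
theorem source_cons (e : QuiverArrow V) (l : List (QuiverArrow V)) (b : V) :
    source (e :: l) b = e.s := rfl

@[simp]
theorem isPath_nil (b : V) : IsPath [] b := trivial

@[simp]
theorem isPath_cons {e : QuiverArrow V} {l : List (QuiverArrow V)} {b : V} :
    IsPath (e :: l) b ↔ e.r = source l b ∧ IsPath l b := Iff.rfl

@[simp]
theorem source_append (l m : List (QuiverArrow V)) (b : V) :
    source (l ++ m) b = source l (source m b) := by
  cases l <;> rfl

theorem isPath_append {l m : List (QuiverArrow V)} {b : V} :
    IsPath (l ++ m) b ↔ IsPath l (source m b) ∧ IsPath m b := by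
  induction l with
  | nil => simp
  | cons e l ih => simp [ih, and_assoc]

end QuiverArrow

open QuiverArrow

/-- There is a path of positive length from `a` to `b`. -/
def QuiverReach (a b : V) : Prop := Relation.TransGen (fun a b : V => Nonempty (a ⟶ b)) a b

theorem QuiverReach.trans {a b c : V} (h : QuiverReach a b) (h' : QuiverReach b c) :
    QuiverReach a c :=
  Relation.TransGen.trans h h'

theorem QuiverReach.arrow (e : QuiverArrow V) : QuiverReach e.s e.r :=
  .single ⟨e.2.2⟩

theorem QuiverReach.exists_isPath {a b : V} (h : QuiverReach a b) :
    ∃ l : List (QuiverArrow V), l ≠ [] ∧ IsPath l b ∧ source l b = a := by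
  induction h using Relation.TransGen.head_induction_on with
  | single h =>
    obtain ⟨e⟩ := h
    exact ⟨[⟨_, _, e⟩], List.cons_ne_nil _ _, ⟨rfl, isPath_nil b⟩, rfl⟩
  | head h _ ih =>
    obtain ⟨e⟩ := h
    obtain ⟨l, -, hl, hs⟩ := ih
    exact ⟨⟨_, _, e⟩ :: l, List.cons_ne_nil _ _, ⟨hs.symm, hl⟩, rfl⟩

theorem QuiverArrow.IsPath.reach {l : List (QuiverArrow V)} {b : V} (hl : IsPath l b)
    (hne : l ≠ []) : QuiverReach (source l b) b := by
  induction l with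
  | nil => exact absurd rfl hne
  | cons e l ih =>
    obtain ⟨he, hl⟩ := isPath_cons.mp hl
    have hstep := QuiverReach.arrow e
    rw [he] at hstep
    obtain rfl | h := eq_or_ne l []
    · exact hstep
    · exact hstep.trans (ih hl h)

theorem QuiverArrow.IsPath.reach_source {e : QuiverArrow V} {l : List (QuiverArrow V)} {b : V}
    (hl : IsPath (e :: l) b) {f : QuiverArrow V} (hf : f ∈ l) : QuiverReach e.s f.s := by
  obtain ⟨l₁, l₂, rfl⟩ := List.append_of_mem hf
  rw [← List.cons_append, isPath_append] at hl
  exact hl.1.reach (List.cons_ne_nil _ _)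

end Paths

namespace LeavittPathAlgebra

open QuiverArrow

section PathElements

variable (K : Type w) [Field K] {V : Type u} [Quiver.{v} V]

/-- The product of the list of arrows `l`, followed by the vertex `b`. It vanishes unless `l` is a
path that ends at `b`. -/
noncomputable def path : List (QuiverArrow V) → V → LeavittPathAlgebra K V
  | [], b => vertex K b
  | e :: l, b => arrow K e * path l b

@[simp]
theorem path_nil (b : V) : path K [] b = vertex K b := rfl

theorem path_cons (e : QuiverArrow V) (l : List (QuiverArrow V)) (b : V) :
    path K (e :: l) b = arrow K e * path K l b := rfl

variable {K}

theorem source_mul_path (l : List (QuiverArrow V)) (b : V) :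
    vertex K (source l b) * path K l b = path K l b := by
  cases l with
  | nil => exact vertex_mul_self b
  | cons e l => rw [path_cons, ← mul_assoc, source_cons, source_mul_arrow]

theorem vertex_mul_path {a b : V} {l : List (QuiverArrow V)} (h : source l b = a) :
    vertex K a * path K l b = path K l b :=
  h ▸ source_mul_path l b

theorem vertex_mul_path_of_ne {a b : V} {l : List (QuiverArrow V)} (h : a ≠ source l b) :
    vertex K a * path K l b = 0 := by
  rw [← source_mul_path, ← mul_assoc, vertex_mul_of_ne h, zero_mul]

theorem path_mul_vertex (l : List (QuiverArrow V)) (b : V) :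
    path K l b * vertex K b = path K l b := by
  induction l with
  | nil => exact vertex_mul_self b
  | cons e l ih => rw [path_cons, mul_assoc, ih]

theorem path_append (l m : List (QuiverArrow V)) (b : V) :
    path K (l ++ m) b = path K l (source m b) * path K m b := by
  induction l with
  | nil => exact (source_mul_path m b).symm
  | cons e l ih => rw [List.cons_append, path_cons, path_cons, ih, mul_assoc]

theorem star_path_mul_path_self {l : List (QuiverArrow V)} {b : V} (h : IsPath l b) :
    star (path K l b) * path K l b = vertex K b := by
  induction l with
  | nil => rw [path_nil, star_vertex, vertex_mul_self]
  | cons e l ih =>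
    rw [isPath_cons] at h
    rw [path_cons, star_mul, star_arrow, mul_assoc, ← mul_assoc (ghost K e), ghost_mul_arrow_self,
      h.1, source_mul_path, ih h.2]

theorem path_singleton (e : QuiverArrow V) : path K [e] e.r = arrow K e := arrow_mul_range e

variable (K V) in
/-- The products `p q*` of paths `p` and ghost paths `q*`, where `p` and `q` end at the same
vertex. -/
def pathProducts : Set (LeavittPathAlgebra K V) :=
  {x | ∃ l m b, IsPath l b ∧ IsPath m b ∧ path K l b * star (path K m b) = x}

theorem mul_star_path_mem_pathProducts {l m : List (QuiverArrow V)} {b : V} (hl : IsPath l b)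
    (hm : IsPath m b) : path K l b * star (path K m b) ∈ pathProducts K V :=
  ⟨l, m, b, hl, hm, rfl⟩

theorem vertex_mul_eq_zero_or_mem_pathProducts (a : V) {x : LeavittPathAlgebra K V}
    (hx : x ∈ pathProducts K V) : vertex K a * x = 0 ∨ vertex K a * x ∈ pathProducts K V := by
  obtain ⟨l, m, b, hl, hm, rfl⟩ := hx
  rw [← mul_assoc]
  obtain rfl | h := eq_or_ne a (source l b)
  · rw [source_mul_path]
    exact .inr (mul_star_path_mem_pathProducts hl hm)
  · rw [vertex_mul_path_of_ne h, zero_mul]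
    exact .inl rfl

theorem arrow_mul_eq_zero_or_mem_pathProducts (e : QuiverArrow V) {x : LeavittPathAlgebra K V}
    (hx : x ∈ pathProducts K V) : arrow K e * x = 0 ∨ arrow K e * x ∈ pathProducts K V := by
  obtain ⟨l, m, b, hl, hm, rfl⟩ := hx
  rw [← mul_assoc]
  by_cases h : e.r = source l b
  · exact .inr (mul_star_path_mem_pathProducts (l := e :: l) ⟨h, hl⟩ hm)
  · rw [← arrow_mul_range, mul_assoc (arrow K e), vertex_mul_path_of_ne h, mul_zero, zero_mul]
    exact .inl rfl

theorem ghost_mul_eq_zero_or_mem_pathProducts (e : QuiverArrow V) {x : LeavittPathAlgebra K V}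
    (hx : x ∈ pathProducts K V) : ghost K e * x = 0 ∨ ghost K e * x ∈ pathProducts K V := by
  obtain ⟨l, m, b, hl, hm, rfl⟩ := hx
  rw [← mul_assoc]
  obtain _ | ⟨f, l⟩ := l
  · rw [path_nil, ← star_vertex, ← star_arrow, ← star_mul]
    obtain rfl | h := eq_or_ne b e.s
    · have hpath : path K (m ++ [e]) e.r = path K m e.s * arrow K e := by
        rw [path_append, path_singleton, source_cons]
      rw [source_mul_arrow, ← star_mul, ← hpath]
      refine .inr ⟨[], m ++ [e], e.r, isPath_nil _, isPath_append.mpr ⟨hm, rfl, trivial⟩, ?_⟩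
      rw [path_nil, ← star_vertex, ← star_mul, path_mul_vertex]
    · rw [vertex_mul_arrow_of_ne h, star_zero, zero_mul]
      exact .inl rfl
  · rw [path_cons, ← mul_assoc]
    obtain rfl | h := eq_or_ne e f
    · rw [isPath_cons] at hl
      rw [ghost_mul_arrow_self, hl.1, source_mul_path]
      exact .inr (mul_star_path_mem_pathProducts hl.2 hm)
    · rw [ghost_mul_arrow_of_ne h, zero_mul, zero_mul]
      exact .inl rfl

theorem gen_mem_pathProducts (g : LeavittGen V) : gen K g ∈ pathProducts K V := by
  obtain a | e | e := g
  · refine ⟨[], [], a, isPath_nil a, isPath_nil a, ?_⟩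
    exact (congrArg _ (star_vertex a)).trans (vertex_mul_self a)
  · refine ⟨[e], [], e.r, ⟨rfl, trivial⟩, isPath_nil _, ?_⟩
    rw [path_singleton, path_nil, star_vertex]
    exact arrow_mul_range e
  · refine ⟨[], [e], e.r, isPath_nil _, ⟨rfl, trivial⟩, ?_⟩
    rw [path_singleton, path_nil, star_arrow]
    exact range_mul_ghost e

theorem span_pathProducts : Submodule.span K (pathProducts K V) = ⊤ := by
  have hgen (g : LeavittGen V) : Submodule.span K (pathProducts K V) ≤
      (Submodule.span K (pathProducts K V)).comap (LinearMap.mulLeft K (gen K g)) := by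
    refine Submodule.span_le.mpr fun x hx => Submodule.mem_comap.mpr ?_
    have hgx : gen K g * x = 0 ∨ gen K g * x ∈ pathProducts K V := by
      obtain a | e | e := g
      · exact vertex_mul_eq_zero_or_mem_pathProducts a hx
      · exact arrow_mul_eq_zero_or_mem_pathProducts e hx
      · exact ghost_mul_eq_zero_or_mem_pathProducts e hx
    obtain h | h := hgx
    · exact (LinearMap.mulLeft_apply K (gen K g) x).trans h ▸ zero_mem _
    · exact Submodule.subset_span h
  refine eq_top_iff.mpr fun x _ => ?_
  induction x using induction_words with
  | zero => exact zero_mem _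
  | add x y hx hy => exact add_mem (hx trivial) (hy trivial)
  | smul k x hx => exact Submodule.smul_mem _ k (hx trivial)
  | base g => exact Submodule.subset_span (gen_mem_pathProducts g)
  | gen_mul g x hx => exact hgen g (hx trivial)

end PathElements

end LeavittPathAlgebra

/-! ### Vertices are nonzero -/

section Representation

variable {K : Type w} [Field K] {V : Type u} {M : Type*} [AddCommGroup M] [Module K M]

/-- The endomorphism of `V →₀ M` whose matrix has the entry `T` in position `(a, b)` and zero
elsewhere. -/
noncomputable def matrixUnitEnd (a b : V) : Module.End K M →+ Module.End K (V →₀ M) where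
  toFun T := Finsupp.lsingle a ∘ₗ T ∘ₗ Finsupp.lapply b
  map_zero' := by simp
  map_add' := by simp [LinearMap.add_comp, LinearMap.comp_add]

theorem matrixUnitEnd_mul (a b c : V) (S T : Module.End K M) :
    matrixUnitEnd a b S * matrixUnitEnd b c T = matrixUnitEnd a c (S * T) := by
  ext : 2
  simp [matrixUnitEnd]

theorem matrixUnitEnd_mul_of_ne (a d : V) {b c : V} (h : b ≠ c) (S T : Module.End K M) :
    matrixUnitEnd a b S * matrixUnitEnd c d T = 0 := by
  ext : 2
  simp [matrixUnitEnd, h]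

theorem matrixUnitEnd_one_ne_zero [Nontrivial M] (a : V) :
    matrixUnitEnd a a (1 : Module.End K M) ≠ 0 := by
  obtain ⟨m, hm⟩ := exists_ne (0 : M)
  intro h
  have h' := LinearMap.congr_fun h (Finsupp.single a m)
  simp [matrixUnitEnd, hm] at h'

variable [Quiver.{v} V]

/-- Endomorphisms `ι e` and `π e` of a module, indexed by the arrows of a quiver, which for each
vertex `a` that emits arrows embed into the module mutually disjoint copies of itself, one for each
arrow with source `a`, and which exhibit the module as the direct sum of these copies if there are
only finitely many of them. -/
structure IsCuntzFamily (ι π : QuiverArrow V → Module.End K M) : Prop where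
  proj_mul_incl_self (e : QuiverArrow V) : π e * ι e = 1
  proj_mul_incl_of_ne {a : V} {e f : Quiver.Star a} (h : e ≠ f) : π ⟨a, e⟩ * ι ⟨a, f⟩ = 0
  sum_incl_mul_proj (a : V) [Fintype (Quiver.Star a)] [Nonempty (Quiver.Star a)] :
    ∑ e : Quiver.Star a, ι ⟨a, e⟩ * π ⟨a, e⟩ = 1

theorem nonempty_star_prod_equiv (a : V) [Nonempty (Quiver.Star a)] :
    Nonempty (Quiver.Star a × (QuiverArrow V ⊕ ℕ) ≃ QuiverArrow V ⊕ ℕ) := by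
  have hstar : Function.Injective fun e : Quiver.Star a =>
      (Sum.inl ⟨a, e⟩ : QuiverArrow V ⊕ ℕ) := fun e f h => by simpa using h
  rw [← Cardinal.eq, Cardinal.mk_prod, Cardinal.lift_id, Cardinal.lift_id]
  exact Cardinal.mul_eq_right (Cardinal.aleph0_le_mk _) (Cardinal.mk_le_of_injective hstar)
    (Cardinal.mk_ne_zero _)

variable (K V) in
theorem exists_isCuntzFamily :
    ∃ ι π : QuiverArrow V → Module.End K ((QuiverArrow V ⊕ ℕ) →₀ K), IsCuntzFamily ι π := by
  have hψ (a : V) (_ : Nonempty (Quiver.Star a)) : Nonempty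
      ((Quiver.Star a →₀ (QuiverArrow V ⊕ ℕ) →₀ K) ≃ₗ[K] (QuiverArrow V ⊕ ℕ) →₀ K) :=
    (nonempty_star_prod_equiv a).map fun g =>
      (Finsupp.curryLinearEquiv K).symm ≪≫ₗ Finsupp.domLCongr g
  let ψ (a : V) (h : Nonempty (Quiver.Star a)) := (hψ a h).some
  refine ⟨fun e => ψ e.s ⟨e.2⟩ ∘ₗ Finsupp.lsingle e.2,
    fun e => Finsupp.lapply e.2 ∘ₗ (ψ e.s ⟨e.2⟩).symm,
    fun e => LinearMap.ext fun x => ?_, fun {a e f} h => LinearMap.ext fun x => ?_,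
    fun a _ ha => LinearMap.ext fun x => ?_⟩
  · simp
  · simp [h]
  · simp only [LinearMap.sum_apply, Module.End.mul_apply, Module.End.one_apply,
      LinearMap.comp_apply, LinearEquiv.coe_coe, Finsupp.lsingle_apply, Finsupp.lapply_apply]
    exact (map_sum (ψ a ha) _ _).symm.trans <|
      (congrArg (ψ a ha) (Finsupp.univ_sum_single _)).trans ((ψ a ha).apply_symm_apply x)

theorem IsCuntzFamily.exists_hom {ι π : QuiverArrow V → Module.End K M} (h : IsCuntzFamily ι π) :
    ∃ φ : LeavittPathAlgebra K V →ₙₐ[K] Module.End K (V →₀ M),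
      ∀ a, φ (LeavittPathAlgebra.vertex K a) = matrixUnitEnd a a 1 := by
  refine ⟨LeavittPathAlgebra.lift (fun g => match g with
    | .vertex a => matrixUnitEnd a a 1
    | .arrow e => matrixUnitEnd e.s e.r (ι e)
    | .ghost e => matrixUnitEnd e.r e.s (π e)) ?_, fun a => LeavittPathAlgebra.lift_gen _ _ _⟩
  rintro _ _ (a | ⟨a, b, hab⟩ | e | e | e | e | e | ⟨e, f, hef⟩ | @⟨a, _, _⟩) <;>
    simp only [map_mul, map_zero, map_sum, LeavittPathAlgebra.freeLift_gen, matrixUnitEnd_mul,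
      one_mul, mul_one]
  · exact matrixUnitEnd_mul_of_ne _ _ hab _ _
  · rw [h.proj_mul_incl_self]
  · obtain ⟨a, e⟩ := e
    obtain ⟨b, f⟩ := f
    rcases eq_or_ne a b with rfl | hab
    · rw [matrixUnitEnd_mul, h.proj_mul_incl_of_ne fun hf => hef (congrArg (Sigma.mk a) hf),
        map_zero]
    · exact matrixUnitEnd_mul_of_ne _ _ hab _ _
  · rw [← h.sum_incl_mul_proj a, map_sum]

namespace LeavittPathAlgebra

variable (K) in
theorem vertex_ne_zero (a : V) : vertex K a ≠ 0 := by
  obtain ⟨ι, π, h⟩ := exists_isCuntzFamily K V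
  obtain ⟨φ, hφ⟩ := h.exists_hom
  intro ha
  exact matrixUnitEnd_one_ne_zero a ((hφ a).symm.trans ((congrArg φ ha).trans (map_zero φ)))

end LeavittPathAlgebra

end Representation

/-! ### Necessary conditions -/

section Necessity

open LaurentPolynomial AddMonoidAlgebra

theorem mul_pow_ne_zero_of_mul_mul_eq {M : Type*} [MonoidWithZero M] {c d v : M}
    (h : d * v * c = v) (hv : v ≠ 0) (k : ℕ) : v * c ^ k ≠ 0 := by
  have hk : d ^ k * v * c ^ k = v := by
    induction k with
    | zero => rw [pow_zero, pow_zero, one_mul, mul_one]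
    | succ k ih =>
      calc d ^ (k + 1) * v * c ^ (k + 1) = d ^ k * (d * v * c) * c ^ k := by
            rw [pow_succ, pow_succ']
            simp only [mul_assoc]
        _ = v := by rw [h, ih]
  intro h0
  rw [mul_assoc, h0, mul_zero] at hk
  exact hv hk.symm

/-- No vertex of the quiver lies on a closed path. -/
def IsAcyclicQuiver (V : Type u) [Quiver.{v} V] : Prop := ∀ a : V, ¬ QuiverReach a a

/-- No closed path has an exit: a vertex on a closed path emits a single arrow. -/
def IsNoExitQuiver (V : Type u) [Quiver.{v} V] : Prop :=
  ∀ a : V, QuiverReach a a → Subsingleton (Quiver.Star a)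

namespace LeavittPathAlgebra

open QuiverArrow

variable {K : Type w} [Field K] {V : Type u} [Quiver.{v} V]

variable (K V) in
/-- The grading of the Leavitt path algebra for which vertices, arrows and ghost arrows have the
degrees `0`, `1` and `-1`, encoded as the homomorphism which multiplies a homogeneous element of
degree `n` by `T ^ n`. The unitization is needed since Laurent polynomials require a unital
coefficient ring. -/
noncomputable def gradingHom :
    LeavittPathAlgebra K V →ₙₐ[K] (Unitization K (LeavittPathAlgebra K V))[T;T⁻¹] :=
  lift (fun g => match g with
    | .vertex a => single 0 (Unitization.inr (vertex K a))
    | .arrow e => single 1 (Unitization.inr (arrow K e))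
    | .ghost e => single (-1) (Unitization.inr (ghost K e))) <| by
    rintro _ _ (a | ⟨a, b, h⟩ | e | e | e | e | e | ⟨e, f, h⟩ | @⟨a, _, _⟩) <;>
      simp only [map_mul, map_zero, map_sum, freeLift_gen, single_mul_single, ← Unitization.inr_mul]
    · simp [vertex_mul_self]
    · simp [vertex_mul_of_ne h]
    · simp [source_mul_arrow]
    · simp [arrow_mul_range]
    · simp [range_mul_ghost]
    · simp [ghost_mul_source]
    · simp [ghost_mul_arrow_self]
    · simp [ghost_mul_arrow_of_ne h]
    · rw [vertex_eq_sum a, add_neg_cancel]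
      exact map_sum ((singleAddHom (0 : ℤ)).comp
        (Unitization.inrHom K K (LeavittPathAlgebra K V)).toAddMonoidHom) _ _

theorem gradingHom_vertex (a : V) :
    gradingHom K V (vertex K a) = single 0 (Unitization.inr (vertex K a)) := lift_gen _ _ _

theorem gradingHom_path (l : List (QuiverArrow V)) (b : V) :
    gradingHom K V (path K l b) = single (l.length : ℤ) (Unitization.inr (path K l b)) := by
  induction l with
  | nil => exact gradingHom_vertex b
  | cons e l ih =>
    have he : gradingHom K V (arrow K e) = single 1 (Unitization.inr (arrow K e)) := lift_gen _ _ _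
    rw [path_cons, map_mul, ih, he, single_mul_single, ← Unitization.inr_mul, List.length_cons,
      Nat.cast_succ, add_comm]

section ClosedPath

variable {l : List (QuiverArrow V)} {a : V} (hl : IsPath l a) (hs : source l a = a)
include hl hs

theorem vertex_mul_pow_path_ne_zero (k : ℕ) :
    (Unitization.inr (vertex K a) : Unitization K (LeavittPathAlgebra K V)) *
      Unitization.inr (path K l a) ^ k ≠ 0 := by
  refine mul_pow_ne_zero_of_mul_mul_eq (d := Unitization.inr (star (path K l a))) ?_
    (fun h => vertex_ne_zero K a (Unitization.inr_injective h)) k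
  rw [← Unitization.inr_mul, ← Unitization.inr_mul, mul_assoc, vertex_mul_path hs,
    star_path_mul_path_self hl]

end ClosedPath

theorem isAcyclicQuiver_of_isVonNeumannRegular (h : IsVonNeumannRegular (LeavittPathAlgebra K V)) :
    IsAcyclicQuiver V := by
  intro a ha
  obtain ⟨l, hne, hl, hs⟩ := ha.exists_isPath
  exact not_isVonNeumannRegular_of_single
    (gradingHom K V : _ →ₙ+* (Unitization K (LeavittPathAlgebra K V))[T;T⁻¹])
    (Int.natCast_pos.2 (List.length_pos_iff.2 hne)) (gradingHom_vertex a) (gradingHom_path l a)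
    (vertex_mul_path hs) (path_mul_vertex l a) (vertex_mul_pow_path_ne_zero hl hs) h

theorem isAcyclicQuiver_of_isLeftArtinian (h : IsLeftArtinian (LeavittPathAlgebra K V)) :
    IsAcyclicQuiver V := by
  intro a ha
  obtain ⟨l, hne, hl, hs⟩ := ha.exists_isPath
  exact not_isLeftArtinian_of_single (x := vertex K a)
    (gradingHom K V : _ →ₙ+* (Unitization K (LeavittPathAlgebra K V))[T;T⁻¹])
    (Int.natCast_pos.2 (List.length_pos_iff.2 hne)) (gradingHom_vertex a) (gradingHom_path l a)
    (vertex_mul_pow_path_ne_zero hl hs) h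

section ChainConditions

variable (h : IsLeftNoetherian (LeavittPathAlgebra K V) ∨ IsLeftArtinian (LeavittPathAlgebra K V))
include h

theorem finite_vertices_of_chainCondition : Finite V :=
  finite_of_star_orthogonal h (x := vertex K)
    (fun a => by simp only [IsIdempotentElem, star_vertex, vertex_mul_self])
    (fun a => by simpa only [star_vertex, vertex_mul_self] using vertex_ne_zero K a)
    (fun a b hab => by simpa only [star_vertex] using vertex_mul_of_ne hab)

theorem finite_arrows_of_chainCondition : Finite (QuiverArrow V) :=
  finite_of_star_orthogonal h (x := arrow K)
    (fun e => by simp only [IsIdempotentElem, star_arrow, ghost_mul_arrow_self, vertex_mul_self])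
    (fun e => by simpa only [star_arrow, ghost_mul_arrow_self] using vertex_ne_zero K e.r)
    (fun e f hef => by simpa only [star_arrow] using ghost_mul_arrow_of_ne hef)

theorem isNoExitQuiver_of_chainCondition : IsNoExitQuiver V := by
  intro a ha
  obtain ⟨l', hne, hl, hs⟩ := ha.exists_isPath
  obtain ⟨e, l, rfl⟩ := List.exists_cons_of_ne_nil hne
  obtain ⟨b, e⟩ := e
  obtain rfl : b = a := hs
  suffices heq : ∀ f : Quiver.Star b, f = e from ⟨fun f g => (heq f).trans (heq g).symm⟩
  intro f
  by_contra hfe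
  set c := path K (⟨b, e⟩ :: l) b with hc
  have hcc : star c * c = vertex K b := star_path_mul_path_self hl
  have hvc : vertex K b * c = c := source_mul_path _ b
  have hvf : vertex K b * arrow K ⟨b, f⟩ = arrow K ⟨b, f⟩ := source_mul_arrow _
  have hff : star (arrow K ⟨b, f⟩) * arrow K ⟨b, f⟩ = vertex K f.1 := by
    rw [star_arrow, ghost_mul_arrow_self]
  have hfc : star (arrow K ⟨b, f⟩) * c = 0 := by
    rw [hc, path_cons, ← mul_assoc, star_arrow, ghost_mul_arrow_of_ne (by simpa using hfe),
      zero_mul]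
  have hself (i : ℕ) : star ((c * ·)^[i] (arrow K ⟨b, f⟩)) * (c * ·)^[i] (arrow K ⟨b, f⟩) =
      vertex K f.1 := (star_iterate_mul_iterate_add hcc hvc hvf i 0).trans hff
  exact not_finite_iff_infinite.2 inferInstance <| finite_of_star_orthogonal h
    (fun i => by rw [IsIdempotentElem, hself, vertex_mul_self])
    (fun i => by rw [hself]; exact vertex_ne_zero K _)
    (pairwise_star_iterate_mul_iterate hcc hvc hvf hfc)

end ChainConditions

end LeavittPathAlgebra

end Necessity

/-! ### Acyclic quivers -/

section Acyclic

variable {V : Type u} [Quiver.{v} V]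

open QuiverArrow

/-- The paths that end at `b` and traverse only arrows in `F`. -/
def pathsIn (F : Finset (QuiverArrow V)) (b : V) : Set (List (QuiverArrow V)) :=
  {l | IsPath l b ∧ ∀ e ∈ l, e ∈ F}

theorem append_singleton_mem_pathsIn {F : Finset (QuiverArrow V)} {l : List (QuiverArrow V)}
    {e : QuiverArrow V} (hl : l ∈ pathsIn F e.s) (he : e ∈ F) : l ++ [e] ∈ pathsIn F e.r :=
  ⟨isPath_append.mpr ⟨hl.1, rfl, trivial⟩, by
    simpa only [List.mem_append, List.mem_singleton, or_imp, forall_and, forall_eq] using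
      ⟨hl.2, he⟩⟩

theorem IsAcyclicQuiver.nodup (hV : IsAcyclicQuiver V) {l : List (QuiverArrow V)} {b : V}
    (hl : IsPath l b) : l.Nodup := by
  induction l with
  | nil => exact List.nodup_nil
  | cons e l ih => exact List.nodup_cons.mpr ⟨fun he => hV _ (hl.reach_source he), ih hl.2⟩

theorem IsAcyclicQuiver.length_le_card (hV : IsAcyclicQuiver V) {F : Finset (QuiverArrow V)}
    {l : List (QuiverArrow V)} {b : V} (hl : l ∈ pathsIn F b) : l.length ≤ F.card := by
  classical
  rw [← List.toFinset_card_of_nodup (hV.nodup hl.1)]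
  exact Finset.card_le_card fun f hf => hl.2 f (List.mem_toFinset.mp hf)

theorem IsAcyclicQuiver.finite_pathsIn (hV : IsAcyclicQuiver V) (F : Finset (QuiverArrow V))
    (b : V) : (pathsIn F b).Finite := by
  refine ((List.finite_length_le F F.card).image (List.map Subtype.val)).subset fun l hl => ?_
  have hlen := hV.length_le_card hl
  obtain ⟨-, hF⟩ := hl
  lift l to List F using hF
  exact ⟨l, by simpa using hlen, rfl⟩

namespace LeavittPathAlgebra

variable (K : Type w) [Field K] (F : Finset (QuiverArrow V))

/-- The products `p q*` in which the paths `p` and `q` traverse only arrows in `F`. -/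
def pathProductsIn : Set (LeavittPathAlgebra K V) :=
  {x | ∃ b, ∃ l ∈ pathsIn F b, ∃ m ∈ pathsIn F b, path K l b * star (path K m b) = x}

open Classical in
/-- The idempotent `b - ∑ e e*`, where `e` ranges over the arrows in `F` with source `b`. -/
noncomputable def cap (b : V) : LeavittPathAlgebra K V :=
  vertex K b - ∑ e ∈ F with e.s = b, arrow K e * ghost K e

/-- The element `p c q*` for paths `p` and `q` in `F` that end at `b`, where `c = cap K F b`. The
factor `c` makes these elements matrix units, unlike the products `p q*`. -/
noncomputable def pathMatrixUnit (b : V) (l m : pathsIn F b) : LeavittPathAlgebra K V :=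
  path K l.1 b * cap K F b * star (path K m.1 b)

variable {K F}

section Cap

theorem star_cap (b : V) : star (cap K F b) = cap K F b := by
  simp only [cap, star_sub, star_sum, star_mul, star_vertex, ← star_arrow, star_star]

theorem cap_mul_arrow {e : QuiverArrow V} (he : e ∈ F) (b : V) : cap K F b * arrow K e = 0 := by
  classical
  have hne (f : QuiverArrow V) (hf : f ≠ e) : arrow K f * ghost K f * arrow K e = 0 := by
    rw [mul_assoc, ghost_mul_arrow_of_ne hf, mul_zero]
  rw [cap, sub_mul, Finset.sum_mul, sub_eq_zero]
  obtain rfl | hb := eq_or_ne b e.s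
  · rw [source_mul_arrow, Finset.sum_eq_single_of_mem e (by simpa using he) fun f _ => hne f,
      mul_assoc, ghost_mul_arrow_self, arrow_mul_range]
  · rw [vertex_mul_arrow_of_ne hb]
    refine (Finset.sum_eq_zero fun f hf => hne f ?_).symm
    rintro rfl
    exact hb (Finset.mem_filter.mp hf).2.symm

theorem cap_mul_vertex (b : V) : cap K F b * vertex K b = cap K F b := by
  classical
  rw [cap, sub_mul, vertex_mul_self, Finset.sum_mul]
  congr 1
  refine Finset.sum_congr rfl fun e he => ?_
  rw [mul_assoc, ← (Finset.mem_filter.mp he).2, ghost_mul_source]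

theorem cap_mul_cap_self (b : V) : cap K F b * cap K F b = cap K F b := by
  classical
  nth_rw 2 [cap]
  rw [mul_sub, cap_mul_vertex, Finset.mul_sum, Finset.sum_eq_zero, sub_zero]
  intro e he
  rw [← mul_assoc, cap_mul_arrow (Finset.mem_filter.mp he).1, zero_mul]

theorem vertex_mul_cap (b : V) : vertex K b * cap K F b = cap K F b := by
  simpa only [star_mul, star_vertex, star_cap] using congrArg star (cap_mul_vertex (F := F) b)

theorem cap_mul_path_cons {e : QuiverArrow V} (he : e ∈ F) (l : List (QuiverArrow V)) (b c : V) :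
    cap K F b * path K (e :: l) c = 0 := by
  rw [path_cons, ← mul_assoc, cap_mul_arrow he, zero_mul]

theorem star_path_cons_mul_cap {e : QuiverArrow V} (he : e ∈ F) (l : List (QuiverArrow V))
    (b c : V) : star (path K (e :: l) c) * cap K F b = 0 := by
  simpa only [star_mul, star_cap, star_zero] using congrArg star (cap_mul_path_cons he l b c)

theorem cap_mul_star_path_mul_path_mul_cap_self {l : List (QuiverArrow V)} {b : V}
    (hl : IsPath l b) :
    cap K F b * (star (path K l b) * path K l b) * cap K F b = cap K F b := by
  rw [star_path_mul_path_self hl, cap_mul_vertex, cap_mul_cap_self]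

theorem cap_mul_star_path_mul_path_mul_cap_of_ne {l m : List (QuiverArrow V)} {b c : V}
    (hl : l ∈ pathsIn F c) (hm : m ∈ pathsIn F b) (hne : b ≠ c ∨ m ≠ l) :
    cap K F b * (star (path K m b) * path K l c) * cap K F c = 0 := by
  induction m generalizing l with
  | nil =>
    obtain _ | ⟨f, l⟩ := l
    · have hbc : b ≠ c := by simpa using hne
      rw [path_nil, path_nil, star_vertex, vertex_mul_of_ne hbc, mul_zero, zero_mul]
    · rw [path_nil, star_vertex, ← mul_assoc, cap_mul_vertex,
        cap_mul_path_cons (hl.2 f List.mem_cons_self), zero_mul]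
  | cons e m ih =>
    obtain _ | ⟨f, l⟩ := l
    · rw [path_nil, mul_assoc, mul_assoc, vertex_mul_cap,
        star_path_cons_mul_cap (hm.2 e List.mem_cons_self), mul_zero]
    rw [path_cons, path_cons, star_mul, star_arrow, mul_assoc (star (path K m b)),
      ← mul_assoc (ghost K e)]
    obtain rfl | hef := eq_or_ne e f
    · rw [ghost_mul_arrow_self, vertex_mul_path hl.1.1.symm]
      exact ih ⟨hl.1.2, fun f hf => hl.2 f (List.mem_cons_of_mem e hf)⟩
        ⟨hm.1.2, fun f hf => hm.2 f (List.mem_cons_of_mem e hf)⟩ (by simpa using hne)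
    · rw [ghost_mul_arrow_of_ne hef, zero_mul, mul_zero, mul_zero, zero_mul]

open Classical in
theorem path_mul_star_path_eq_add_sum (l m : List (QuiverArrow V)) (b : V) :
    path K l b * star (path K m b) = path K l b * cap K F b * star (path K m b) +
      ∑ e ∈ F with e.s = b, path K (l ++ [e]) e.r * star (path K (m ++ [e]) e.r) := by
  have hterm (e : QuiverArrow V) (he : e ∈ F.filter fun e => e.s = b) :
      path K (l ++ [e]) e.r * star (path K (m ++ [e]) e.r) =
        path K l b * (arrow K e * ghost K e) * star (path K m b) := by
    obtain rfl := (Finset.mem_filter.mp he).2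
    rw [path_append, path_append, path_singleton, source_cons, star_mul, star_arrow]
    simp only [mul_assoc]
  rw [Finset.sum_congr rfl hterm, ← Finset.sum_mul, ← Finset.mul_sum, ← add_mul, ← mul_add, cap,
    sub_add_cancel, path_mul_vertex]

end Cap

section MatrixUnits

theorem pathMatrixUnit_mul (b c : V) (j l : pathsIn F b) (k m : pathsIn F c) :
    pathMatrixUnit K F b j l * pathMatrixUnit K F c k m = path K j.1 b *
      (cap K F b * (star (path K l.1 b) * path K k.1 c) * cap K F c) * star (path K m.1 c) := by
  simp only [pathMatrixUnit, mul_assoc]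

theorem isMatrixUnits_pathMatrixUnit (b : V) :
    IsMatrixUnits (pathMatrixUnit K F b) where
  mul_eq j l m := by
    rw [pathMatrixUnit_mul, cap_mul_star_path_mul_path_mul_cap_self l.2.1, pathMatrixUnit]
  mul_eq_zero j l k m hlk := by
    rw [pathMatrixUnit_mul, cap_mul_star_path_mul_path_mul_cap_of_ne k.2 l.2
      (.inr (Subtype.coe_injective.ne hlk)), mul_zero, zero_mul]

theorem pathMatrixUnit_mul_of_ne {b c : V} (h : b ≠ c) (j l : pathsIn F b) (k m : pathsIn F c) :
    pathMatrixUnit K F b j l * pathMatrixUnit K F c k m = 0 := by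
  rw [pathMatrixUnit_mul, cap_mul_star_path_mul_path_mul_cap_of_ne k.2 l.2 (.inl h), mul_zero,
    zero_mul]

variable (hV : IsAcyclicQuiver V)
include hV

theorem path_mul_star_path_mem_span_pathMatrixUnit {l m : List (QuiverArrow V)} {b : V}
    (hl : l ∈ pathsIn F b) (hm : m ∈ pathsIn F b) :
    path K l b * star (path K m b) ∈
      Submodule.span K {x | ∃ b l m, pathMatrixUnit K F b l m = x} := by
  classical
  induction hn : F.card - l.length using Nat.strong_induction_on generalizing l m b with
  | _ n ih =>
    rw [path_mul_star_path_eq_add_sum (F := F)]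
    refine add_mem (Submodule.subset_span ⟨b, ⟨l, hl⟩, ⟨m, hm⟩, rfl⟩)
      (Submodule.sum_mem _ fun e he => ?_)
    obtain ⟨heF, rfl⟩ := Finset.mem_filter.mp he
    have hle := append_singleton_mem_pathsIn hl heF
    have hcard := hV.length_le_card hle
    refine ih _ ?_ hle (append_singleton_mem_pathsIn hm heF) rfl
    rw [List.length_append, List.length_singleton] at hcard ⊢
    lia

end MatrixUnits

theorem pathProductsIn_mono : Monotone (pathProductsIn K (V := V)) := by
  rintro F G hFG _ ⟨b, l, hl, m, hm, rfl⟩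
  exact ⟨b, l, ⟨hl.1, fun e he => hFG (hl.2 e he)⟩, m, ⟨hm.1, fun e he => hFG (hm.2 e he)⟩, rfl⟩

theorem exists_mem_span_pathProductsIn (x : LeavittPathAlgebra K V) :
    ∃ F : Finset (QuiverArrow V), x ∈ Submodule.span K (pathProductsIn K F) := by
  classical
  have hsub : pathProducts K V ⊆ ⋃ F, pathProductsIn K F := by
    rintro _ ⟨l, m, b, hl, hm, rfl⟩
    exact Set.mem_iUnion.mpr ⟨l.toFinset ∪ m.toFinset, b, l, ⟨hl, by simp +contextual⟩, m,
      ⟨hm, by simp +contextual⟩, rfl⟩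
  have hx : x ∈ Submodule.span K (⋃ F, pathProductsIn K F) :=
    Submodule.span_mono hsub (span_pathProducts (K := K) (V := V) ▸ Submodule.mem_top)
  rwa [Submodule.span_iUnion, Submodule.mem_iSup_of_directed _ (Monotone.directed_le
    fun _ _ hFG => Submodule.span_mono (pathProductsIn_mono hFG))] at hx

theorem isVonNeumannRegular_of_isAcyclicQuiver (hV : IsAcyclicQuiver V) :
    IsVonNeumannRegular (LeavittPathAlgebra K V) := by
  intro x
  obtain ⟨F, hx⟩ := exists_mem_span_pathProductsIn x
  have (b : V) : Finite (pathsIn F b) := hV.finite_pathsIn F b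
  refine exists_mul_mul_eq_of_mem_span_matrixUnits K
    (fun b => isMatrixUnits_pathMatrixUnit (K := K) (F := F) b)
    (fun b c hbc j l k m => pathMatrixUnit_mul_of_ne hbc j l k m) (Submodule.span_le.mpr ?_ hx)
  rintro _ ⟨b, l, hl, m, hm, rfl⟩
  exact path_mul_star_path_mem_span_pathMatrixUnit hV hl hm

theorem moduleFinite_of_isAcyclicQuiver [Finite V] [Finite (QuiverArrow V)]
    (hV : IsAcyclicQuiver V) : Module.Finite K (LeavittPathAlgebra K V) := by
  cases nonempty_fintype (QuiverArrow V)
  refine ⟨span_pathProducts (K := K) (V := V) ▸ Submodule.fg_span ?_⟩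
  refine (Set.finite_iUnion fun b => ((hV.finite_pathsIn Finset.univ b).prod
    (hV.finite_pathsIn Finset.univ b)).image
      fun p => path K p.1 b * star (path K p.2 b)).subset ?_
  rintro _ ⟨l, m, b, hl, hm, rfl⟩
  exact Set.mem_iUnion.mpr ⟨b, (l, m), ⟨⟨hl, by simp⟩, ⟨hm, by simp⟩⟩, rfl⟩

theorem sum_vertex_mul [Fintype V] (x : LeavittPathAlgebra K V) :
    (∑ a : V, vertex K a) * x = x := by
  have hle : Submodule.span K (pathProducts K V) ≤ LinearMap.eqLocus
      (LinearMap.mulLeft K (∑ a : V, vertex K a)) LinearMap.id := by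
    refine Submodule.span_le.mpr ?_
    rintro _ ⟨l, m, b, -, -, rfl⟩
    rw [SetLike.mem_coe, LinearMap.mem_eqLocus, LinearMap.mulLeft_apply, LinearMap.id_apply]
    rw [← mul_assoc, Finset.sum_mul, Finset.sum_eq_single_of_mem (source l b) (Finset.mem_univ _)
      fun a _ ha => vertex_mul_path_of_ne ha, source_mul_path]
  exact hle (span_pathProducts (K := K) (V := V) ▸ Submodule.mem_top)

theorem isLeftArtinian_of_isAcyclicQuiver [Finite V] [Finite (QuiverArrow V)]
    (hV : IsAcyclicQuiver V) : IsLeftArtinian (LeavittPathAlgebra K V) := by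
  cases nonempty_fintype V
  have := moduleFinite_of_isAcyclicQuiver (K := K) hV
  exact isLeftArtinian_of_isArtinian K sum_vertex_mul

end LeavittPathAlgebra

end Acyclic

/-! ### Quivers in which no cycle has an exit -/

section NoExit

open QuiverArrow

variable {V : Type u} [Quiver.{v} V]

/-- Every vertex that can be reached from `w` reaches `w` in turn. Sinks are terminal, and so are
the vertices on cycles without exits. -/
def IsTerminalVertex (w : V) : Prop := ∀ b, QuiverReach w b → QuiverReach b w

theorem IsTerminalVertex.of_reach {a b : V} (ha : IsTerminalVertex a) (hab : QuiverReach a b) :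
    IsTerminalVertex b :=
  fun c hbc => (ha c (hab.trans hbc)).trans hab

theorem IsTerminalVertex.range {e : QuiverArrow V} (he : IsTerminalVertex e.s) :
    IsTerminalVertex e.r :=
  he.of_reach (.arrow e)

theorem IsTerminalVertex.reach_source_self {e : QuiverArrow V} (he : IsTerminalVertex e.s) :
    QuiverReach e.s e.s :=
  (QuiverReach.arrow e).trans (he _ (.arrow e))

theorem IsTerminalVertex.exists_isPath {w b : V} (hw : IsTerminalVertex w)
    {l : List (QuiverArrow V)} (hl : IsPath l b) (hlw : source l b = w) :
    IsTerminalVertex b ∧ ∃ m, IsPath m w ∧ source m w = b := by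
  obtain rfl | hne := eq_or_ne l []
  · obtain rfl : b = w := hlw
    exact ⟨hw, [], isPath_nil b, rfl⟩
  · have hwb : QuiverReach w b := hlw ▸ hl.reach hne
    obtain ⟨m, -, hm⟩ := (hw b hwb).exists_isPath
    exact ⟨hw.of_reach hwb, m, hm⟩

namespace IsNoExitQuiver

variable (hV : IsNoExitQuiver V)
include hV

theorem reach_of_hom {a b : V} (ha : QuiverReach a a) (e : a ⟶ b) : QuiverReach b a := by
  have := hV a ha
  obtain ⟨c, ⟨f⟩, hca⟩ := Relation.TransGen.head'_iff.mp ha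
  obtain rfl : c = b := congrArg Sigma.fst (Subsingleton.elim (⟨c, f⟩ : Quiver.Star a) ⟨b, e⟩)
  obtain rfl | hca := Relation.reflTransGen_iff_eq_or_transGen.mp hca
  · exact ha
  · exact hca

theorem isTerminalVertex {a : V} (ha : QuiverReach a a) : IsTerminalVertex a := by
  intro b hab
  induction hab with
  | single h => exact hV.reach_of_hom ha h.some
  | tail hab hbc ih => exact (hV.reach_of_hom (ih.trans hab) hbc.some).trans ih

theorem exists_eq_append {l m : List (QuiverArrow V)} {b c : V} (hl : IsPath l b)
    (hm : IsPath m c) (h : source l b = source m c) (hw : IsTerminalVertex (source l b))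
    (hle : l.length ≤ m.length) : ∃ d, m = l ++ d ∧ IsPath d c ∧ source d c = b := by
  induction l generalizing m with
  | nil => exact ⟨m, rfl, hm, h.symm⟩
  | cons e l ih =>
    obtain _ | ⟨f, m⟩ := m
    · simp at hle
    obtain ⟨a, e⟩ := e
    obtain ⟨a', f⟩ := f
    obtain rfl : a = a' := h
    have := hV a hw.reach_source_self
    obtain rfl : e = f := Subsingleton.elim (α := Quiver.Star a) _ _
    obtain ⟨d, rfl, hd⟩ := ih hl.2 hm.2 (hl.1.symm.trans hm.1) (hl.1 ▸ hw.range)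
      (Nat.le_of_succ_le_succ hle)
    exact ⟨d, rfl, hd⟩

theorem exists_eq_flatten_replicate {w : V} (hw : IsTerminalVertex w) :
    ∃ p : List (QuiverArrow V), IsPath p w ∧ source p w = w ∧
      ∀ d, IsPath d w → source d w = w → ∃ n, d = (List.replicate n p).flatten := by
  by_cases hcyc : ∃ l : List (QuiverArrow V), l ≠ [] ∧ IsPath l w ∧ source l w = w
  · obtain ⟨p, ⟨hpne, hp, hps⟩, hpmin⟩ := (measure List.length).wf.has_min _ hcyc
    refine ⟨p, hp, hps, fun d hd hds => ?_⟩
    induction hn : d.length using Nat.strong_induction_on generalizing d with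
    | _ n ih =>
      obtain rfl | hdne := eq_or_ne d []
      · exact ⟨0, rfl⟩
      obtain ⟨d, rfl, hd, hds⟩ := hV.exists_eq_append hp hd (hps.trans hds.symm)
        (hps.symm ▸ hw) (not_lt.mp (hpmin d ⟨hdne, hd, hds⟩))
      have hlt : d.length < n := by
        rw [← hn, List.length_append]
        exact Nat.lt_add_of_pos_left (List.length_pos_iff.mpr hpne)
      obtain ⟨k, rfl⟩ := ih _ hlt d hd hds rfl
      exact ⟨k + 1, rfl⟩
  · exact ⟨[], isPath_nil w, rfl, fun d hd hds =>
      ⟨0, not_not.mp fun hne => hcyc ⟨d, hne, hd, hds⟩⟩⟩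

theorem exists_nodup_append {w : V} {m : List (QuiverArrow V)} (hm : IsPath m w) :
    ∃ q d : List (QuiverArrow V), m = q ++ d ∧ q.Nodup ∧ IsPath d w ∧ source d w = w := by
  induction m with
  | nil => exact ⟨[], [], rfl, List.nodup_nil, isPath_nil w, rfl⟩
  | cons e m ih =>
    obtain ⟨q, d, rfl, hq, hd, hds⟩ := ih hm.2
    by_cases he : e ∈ q
    · obtain ⟨q₁, q₂, rfl⟩ := List.append_of_mem he
      have hqw : IsPath ((e :: q₁) ++ e :: q₂) w := hds ▸ (isPath_append.mp hm).1
      have hcyc : QuiverReach e.s e.s := hqw.reach_source (by simp)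
      -- The cycle through `e` has no exit, so the path that starts at the first occurrence of `e`
      -- in `m` is an initial segment of the whole path.
      obtain ⟨z, hz, hzw, hzs⟩ := hV.exists_eq_append (isPath_append.mp hqw).2 hqw rfl
        (hV.isTerminalVertex hcyc) (by simp; lia)
      refine ⟨e :: q₂, z ++ d, ?_, hq.of_append_right, isPath_append.mpr ⟨hds.symm ▸ hzw, hd⟩, ?_⟩
      · rw [← List.append_assoc, ← hz, List.cons_append, List.cons_append]
      · rw [source_append, hds, hzs]
    · exact ⟨e :: q, d, rfl, List.nodup_cons.mpr ⟨he, hq⟩, hd, hds⟩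

end IsNoExitQuiver

namespace LeavittPathAlgebra

variable {K : Type w} [Field K]

theorem path_mul_star_path_self (hV : IsNoExitQuiver V) {l : List (QuiverArrow V)} {b : V}
    (hl : IsPath l b) (hw : IsTerminalVertex (source l b)) :
    path K l b * star (path K l b) = vertex K (source l b) := by
  induction l with
  | nil => rw [path_nil, star_vertex, vertex_mul_self, source_nil]
  | cons e l ih =>
    have : Subsingleton (Quiver.Star e.s) := hV _ hw.reach_source_self
    let : Unique (Quiver.Star e.s) := uniqueOfSubsingleton ⟨e.r, e.2.2⟩
    rw [path_cons, star_mul, star_arrow, mul_assoc, ← mul_assoc (path K l b),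
      ih hl.2 (hl.1 ▸ hw.range), ← hl.1, range_mul_ghost]
    exact ((vertex_eq_sum e.s).trans (Fintype.sum_unique _)).symm

theorem path_mul_star_path_eq_append (hV : IsNoExitQuiver V) (l m : List (QuiverArrow V))
    {t : List (QuiverArrow V)} {w : V} (ht : IsPath t w) (hw : IsTerminalVertex (source t w)) :
    path K l (source t w) * star (path K m (source t w)) =
      path K (l ++ t) w * star (path K (m ++ t) w) := by
  rw [path_append, path_append, star_mul, mul_assoc, ← mul_assoc (path K t w),
    path_mul_star_path_self hV ht hw, ← star_vertex, ← star_mul, path_mul_vertex]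

theorem mul_mem_of_flatten_replicate {s : Set (LeavittPathAlgebra K V)}
    (N : Submodule (leftMulAdjoin K s) (LeavittPathAlgebra K V)) {p : List (QuiverArrow V)} {w : V}
    (hps : source p w = w) (hw : vertex K w ∈ s) (hp : path K p w ∈ s)
    (hp' : star (path K p w) ∈ s) (n : ℕ) {x : LeavittPathAlgebra K V} (hx : x ∈ N) :
    path K (List.replicate n p).flatten w * x ∈ N ∧
      star (path K (List.replicate n p).flatten w) * x ∈ N := by
  have hsource (n : ℕ) : source (List.replicate n p).flatten w = w := by
    induction n with
    | zero => rfl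
    | succ n ih => rw [List.replicate_succ, List.flatten_cons, source_append, ih, hps]
  induction n generalizing x with
  | zero =>
    have hwx := mul_mem_of_mem_leftMulAdjoin N hw hx
    exact ⟨hwx, (star_vertex (K := K) w).symm ▸ hwx⟩
  | succ n ih =>
    rw [List.replicate_succ, List.flatten_cons, path_append, hsource, star_mul, mul_assoc,
      mul_assoc]
    exact ⟨mul_mem_of_mem_leftMulAdjoin N hp (ih hx).1,
      (ih (mul_mem_of_mem_leftMulAdjoin N hp' hx)).2⟩

theorem vertex_mul_mem_span_star_path (hV : IsNoExitQuiver V) {w : V} (hw : IsTerminalVertex w)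
    {s : Set (LeavittPathAlgebra K V)}
    (hs : ∀ (N : Submodule (leftMulAdjoin K s) (LeavittPathAlgebra K V)) (d), IsPath d w →
      source d w = w → ∀ x ∈ N, path K d w * x ∈ N ∧ star (path K d w) * x ∈ N)
    (x : LeavittPathAlgebra K V) : vertex K w * x ∈
      Submodule.span (leftMulAdjoin K s) ((fun q => star (path K q w)) '' {q | q.Nodup}) := by
  set N := Submodule.span (leftMulAdjoin K s) ((fun q => star (path K q w)) '' {q | q.Nodup})
  have hle : Submodule.span K (pathProducts K V) ≤
      (N.restrictScalars K).comap (LinearMap.mulLeft K (vertex K w)) := by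
    refine Submodule.span_le.mpr ?_
    rintro _ ⟨l, m, b, hl, hm, rfl⟩
    change vertex K w * (path K l b * star (path K m b)) ∈ N
    rw [← mul_assoc]
    obtain hlw | hlw := eq_or_ne w (source l b)
    · obtain ⟨hb, t, ht, htb⟩ := hw.exists_isPath hl hlw.symm
      obtain rfl := htb
      obtain ⟨q, d, hqd, hq, hd, hds⟩ := hV.exists_nodup_append (isPath_append.mpr ⟨hm, ht⟩)
      have hlt : source (l ++ t) w = w := (source_append l t w).trans hlw.symm
      rw [vertex_mul_path hlw.symm, path_mul_star_path_eq_append hV l m ht hb, hqd, path_append q,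
        hds, star_mul]
      refine (hs N (l ++ t) (isPath_append.mpr ⟨hl, ht⟩) hlt _ ?_).1
      exact (hs N d hd hds _ (Submodule.subset_span ⟨q, hq, rfl⟩)).2
    · rw [vertex_mul_path_of_ne hlw, zero_mul]
      exact zero_mem N
  exact hle (span_pathProducts (K := K) (V := V) ▸ Submodule.mem_top)

section Finite

variable [Finite V] [Finite (QuiverArrow V)] (hV : IsNoExitQuiver V)
include hV

theorem leftChainsStabilize_vertex_of_isTerminalVertex {w : V} (hw : IsTerminalVertex w) :
    LeftChainsStabilize (vertex K w) := by
  cases nonempty_fintype V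
  cases nonempty_fintype (QuiverArrow V)
  obtain ⟨p, hp, hps, hgen⟩ := hV.exists_eq_flatten_replicate hw
  let s : Set (LeavittPathAlgebra K V) := {vertex K w, path K p w, star (path K p w)}
  have hvp : vertex K w * path K p w = path K p w := vertex_mul_path hps
  have hvp' : vertex K w * star (path K p w) = star (path K p w) := by
    rw [← star_vertex, ← star_mul, path_mul_vertex]
  have hp'v : star (path K p w) * vertex K w = star (path K p w) := by
    rw [← star_vertex, ← star_mul, hvp]
  have hpp' : path K p w * star (path K p w) = vertex K w := by
    rw [path_mul_star_path_self hV hp (hps.symm ▸ hw), hps]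
  have hcomm : ∀ a ∈ s, ∀ b ∈ s, a * b = b * a := by
    rintro _ (rfl | rfl | rfl) _ (rfl | rfl | rfl) <;>
      simp only [hvp, hvp', hp'v, hpp', path_mul_vertex, star_path_mul_path_self hp]
  have hnodup : {q : List (QuiverArrow V) | q.Nodup}.Finite :=
    (List.finite_length_le _ _).subset fun _ hq => hq.length_le_card
  refine .of_fg sum_vertex_mul (Set.toFinite s) hcomm (Submodule.fg_span (hnodup.image _))
    (vertex_mul_mem_span_star_path hV hw fun N d hd hds x hx => ?_)
  obtain ⟨n, rfl⟩ := hgen d hd hds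
  exact mul_mem_of_flatten_replicate N hps (.inl rfl) (.inr (.inl rfl)) (.inr (.inr rfl)) n hx

theorem leftChainsStabilize_vertex (a : V) : LeftChainsStabilize (vertex K a) := by
  let r (b a : V) : Prop := QuiverReach a b ∧ ¬ QuiverReach b a
  have : IsTrans V r :=
    ⟨fun _ _ _ hab hbc => ⟨hbc.1.trans hab.1, fun h => hab.2 (h.trans hbc.1)⟩⟩
  have : Std.Irrefl r := ⟨fun _ h => h.2 h.1⟩
  induction a using (Finite.wellFounded_of_trans_of_irrefl r).induction with
  | _ a ih =>
    by_cases ha : IsTerminalVertex a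
    · exact leftChainsStabilize_vertex_of_isTerminalVertex hV ha
    have : Finite (Quiver.Star a) := .of_injective _ (sigma_mk_injective (i := a))
    cases nonempty_fintype (Quiver.Star a)
    have : Nonempty (Quiver.Star a) := by
      by_contra hempty
      refine ha fun b hab => absurd (Relation.TransGen.head'_iff.mp hab) ?_
      rintro ⟨c, ⟨e⟩, -⟩
      exact hempty ⟨c, e⟩
    rw [vertex_eq_sum a]
    refine .sum fun e _ => ?_
    have hstep : QuiverReach a e.1 := .arrow ⟨a, e⟩
    have he : LeftChainsStabilize (vertex K e.1) :=
      ih e.1 ⟨hstep, fun h => ha (hV.isTerminalVertex (hstep.trans h))⟩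
    rw [← range_mul_ghost ⟨a, e⟩]
    exact (he.mul_right _).mul_left _

theorem isLeftNoetherian_of_isNoExitQuiver : IsLeftNoetherian (LeavittPathAlgebra K V) := by
  cases nonempty_fintype V
  exact LeftChainsStabilize.isLeftNoetherian
    (.sum fun a _ => leftChainsStabilize_vertex hV a) sum_vertex_mul

end Finite

end LeavittPathAlgebra

end NoExit

/-! ### Transfer to the Kronecker square -/

theorem finite_prod_self_iff {α : Type*} : Finite (α × α) ↔ Finite α :=
  ⟨fun _ => .of_injective (fun a : α => (a, a)) fun _ _ h => congrArg Prod.fst h,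
    fun _ => inferInstance⟩

section Kronecker

variable {V : Type u} [Quiver.{v} V]

namespace KroneckerSquare

theorem quiverReach_diagonal {a b : V} (h : QuiverReach a b) :
    QuiverReach (V := KroneckerSquare V) (a, a) (b, b) :=
  Relation.TransGen.lift (fun a : V => ((a, a) : KroneckerSquare V))
    (fun _ _ ⟨e⟩ => ⟨(e, e)⟩) _ _ h

theorem quiverReach_fst {a b : KroneckerSquare V} (h : QuiverReach a b) :
    QuiverReach a.1 b.1 :=
  Relation.TransGen.lift (fun a : KroneckerSquare V => a.1) (fun _ _ ⟨e⟩ => ⟨e.1⟩) _ _ h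

theorem quiverReach_snd {a b : KroneckerSquare V} (h : QuiverReach a b) :
    QuiverReach a.2 b.2 :=
  Relation.TransGen.lift (fun a : KroneckerSquare V => a.2) (fun _ _ ⟨e⟩ => ⟨e.2⟩) _ _ h

/-- The arrows `[e, f]` with source `a = [a.1, a.2]` are the pairs of an arrow `e` with source
`a.1` and an arrow `f` with source `a.2`. -/
def starEquiv (a : KroneckerSquare V) :
    Quiver.Star a ≃ Quiver.Star a.1 × Quiver.Star a.2 where
  toFun e := (⟨e.1.1, e.2.1⟩, ⟨e.1.2, e.2.2⟩)
  invFun e := ⟨(e.1.1, e.2.1), (e.1.2, e.2.2)⟩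

variable (V) in
/-- The arrow set of the Kronecker square is `Q₁ × Q₁`. -/
def arrowEquiv : QuiverArrow (KroneckerSquare V) ≃ QuiverArrow V × QuiverArrow V where
  toFun e := (⟨e.s.1, e.r.1, e.2.2.1⟩, ⟨e.s.2, e.r.2, e.2.2.2⟩)
  invFun e := ⟨(e.1.s, e.2.s), (e.1.r, e.2.r), (e.1.2.2, e.2.2.2)⟩

theorem isAcyclicQuiver_iff : IsAcyclicQuiver (KroneckerSquare V) ↔ IsAcyclicQuiver V :=
  ⟨fun h a ha => h (a, a) (quiverReach_diagonal ha), fun h a ha => h a.1 (quiverReach_fst ha)⟩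

theorem isNoExitQuiver_iff : IsNoExitQuiver (KroneckerSquare V) ↔ IsNoExitQuiver V := by
  refine ⟨fun h a ha => ?_, fun h a ha => ?_⟩
  · have := h (a, a) (quiverReach_diagonal ha)
    have : Subsingleton (Quiver.Star a × Quiver.Star a) :=
      (starEquiv ((a, a) : KroneckerSquare V)).symm.subsingleton
    exact ⟨fun e f => congrArg Prod.fst (Subsingleton.elim (e, e) (f, f))⟩
  · have := h a.1 (quiverReach_fst ha)
    have := h a.2 (quiverReach_snd ha)
    exact (starEquiv a).subsingleton

theorem finite_iff {V : Type u} : Finite (KroneckerSquare V) ↔ Finite V :=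
  finite_prod_self_iff

theorem finite_quiverArrow_iff :
    Finite (QuiverArrow (KroneckerSquare V)) ↔ Finite (QuiverArrow V) :=
  (arrowEquiv V).finite_iff.trans finite_prod_self_iff

end KroneckerSquare

namespace LeavittPathAlgebra

variable {K : Type w} [Field K]

theorem isVonNeumannRegular_iff :
    IsVonNeumannRegular (LeavittPathAlgebra K V) ↔ IsAcyclicQuiver V :=
  ⟨isAcyclicQuiver_of_isVonNeumannRegular, isVonNeumannRegular_of_isAcyclicQuiver⟩

theorem isLeftNoetherian_iff : IsLeftNoetherian (LeavittPathAlgebra K V) ↔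
    Finite V ∧ Finite (QuiverArrow V) ∧ IsNoExitQuiver V :=
  ⟨fun h => ⟨finite_vertices_of_chainCondition (.inl h), finite_arrows_of_chainCondition (.inl h),
      isNoExitQuiver_of_chainCondition (.inl h)⟩,
    fun ⟨_, _, hV⟩ => isLeftNoetherian_of_isNoExitQuiver hV⟩

theorem isLeftArtinian_iff : IsLeftArtinian (LeavittPathAlgebra K V) ↔
    Finite V ∧ Finite (QuiverArrow V) ∧ IsAcyclicQuiver V :=
  ⟨fun h => ⟨finite_vertices_of_chainCondition (.inr h), finite_arrows_of_chainCondition (.inr h),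
      isAcyclicQuiver_of_isLeftArtinian h⟩,
    fun ⟨_, _, hV⟩ => isLeftArtinian_of_isAcyclicQuiver hV⟩

end LeavittPathAlgebra

end Kronecker

theorem mainTheorem4 (K : Type w) [Field K] (V : Type u) [Quiver.{v} V] :
    (IsVonNeumannRegular (LeavittPathAlgebra K V) ↔
      IsVonNeumannRegular (LeavittPathAlgebra K (KroneckerSquare V))) ∧
    (IsLeftNoetherian (LeavittPathAlgebra K V) ↔
      IsLeftNoetherian (LeavittPathAlgebra K (KroneckerSquare V))) ∧
    (IsRightNoetherian (LeavittPathAlgebra K V) ↔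
      IsRightNoetherian (LeavittPathAlgebra K (KroneckerSquare V))) ∧
    (IsLeftArtinian (LeavittPathAlgebra K V) ↔
      IsLeftArtinian (LeavittPathAlgebra K (KroneckerSquare V))) ∧
    (IsRightArtinian (LeavittPathAlgebra K V) ↔
      IsRightArtinian (LeavittPathAlgebra K (KroneckerSquare V))) := by
  refine ⟨?vonNeumannRegular, ?leftNoetherian, ?rightNoetherian, ?leftArtinian, ?rightArtinian⟩
  case vonNeumannRegular =>
    simp only [LeavittPathAlgebra.isVonNeumannRegular_iff, KroneckerSquare.isAcyclicQuiver_iff]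
  case leftNoetherian =>
    simp only [LeavittPathAlgebra.isLeftNoetherian_iff, KroneckerSquare.finite_iff,
      KroneckerSquare.finite_quiverArrow_iff, KroneckerSquare.isNoExitQuiver_iff]
  case rightNoetherian =>
    simp only [isRightNoetherian_iff_isLeftNoetherian, LeavittPathAlgebra.isLeftNoetherian_iff,
      KroneckerSquare.finite_iff, KroneckerSquare.finite_quiverArrow_iff,
      KroneckerSquare.isNoExitQuiver_iff]
  case leftArtinian =>
    simp only [LeavittPathAlgebra.isLeftArtinian_iff, KroneckerSquare.finite_iff,
      KroneckerSquare.finite_quiverArrow_iff, KroneckerSquare.isAcyclicQuiver_iff]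
  case rightArtinian =>
    simp only [isRightArtinian_iff_isLeftArtinian, LeavittPathAlgebra.isLeftArtinian_iff,
      KroneckerSquare.finite_iff, KroneckerSquare.finite_quiverArrow_iff,
      KroneckerSquare.isAcyclicQuiver_iff]
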